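/- Let $f:\mathbb R^d\to\mathbb R$ be differentiable and $\beta$-smooth, i.e. $\|\nabla f(x)-\nabla f(y)\|\le\beta\|x-y\|$ for all $x,y$, with $\beta>0$. Let $g$ be a stochastic gradient oracle of $f$ with $\mathbb E[g(w)]=\nabla f(w)$ and $\mathbb E\|g(w)-\nabla f(w)\|^2\le\sigma^2$ for every $w$, where $\sigma\ge 0$. Let $w_1\in\mathbb R^d$ and $T\ge 1$, and let $d_1,\dots,d_T$ be arbitrary integer delays fixed in advance with $0\le d_t\le t-1$. In round $t=1,\dots,T$ the algorithm plays a point $w_t$ and receives the pair $(g_t,d_t)$, where $g_t$ is a fresh, independent oracle answer at the point $w_{t-d_t}$. For $q\in(0,1)$ let $\tau_q\ge 0$ be any number with $\frac1T|\{t\le T:d_t\le\tau_q\}|\ge q$ and $\frac1T|\{t\le T:d_t\ge\tau_q\}|\ge 1-q$, and let $\tau_1=\max_{t\le T} d_t$. Asynchronous mini-batching sweep. The input consists of epoch lengths $K_1,K_2,\dots$, batch sizes $B_1,B_2,\dots$ and a first-order method $\mathcal A(K)$ that makes $K$ queries. In epoch $i=1,2,\dots$ a fresh copy of $\mathcal A(K_i)$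 is run. When its current query $\tilde w$ is first played in round $s$, the algorithm keeps playing $w_t=\tilde w$ in rounds $t=s,s+1,\dots$, keeping the received gradient $g_t$ exactly when $t-d_t\ge s$ and discarding it otherwise, until $B_i$ gradients have been kept; their average is sent to $\mathcal A$ as the response to $\tilde w$, and the next query is played from the following round on. After $K_i$ responses the output $\hat w_i$ of $\mathcal A(K_i)$ is recorded and epoch $i+1$ begins. Let $\hat w$ be the last output recorded within the $T$ rounds, and $\hat w=w_1$ if there is none. Take $K_i=2^{i-1}$ throughout. (i) (SGD, non-convex.) Suppose $f\ge f^\star$ everywhere and $F\ge f(w_1)-f^\star$, $F>0$. Let $\mathcal A(K)$ be $K$-step SGD, $x_1=w_1$, $x_{k+1}=x_k-\frac1\beta g_k$, where $g_k$ is the response to the query $x_k$, returning $x_R$ with $R$ uniform on $\{1,\dots,K\}$ and independent of the oracle answers, and let $B_i=\max\{1,\lceil\sigma^2K_i/(2\beta F)\rceil\}$. Then $$\mathbb E\|\nabla f(\hat w)\|^2\le\inf_{q\in(0,1]}\left(\frac{24(1+2\tau_q)\beta F}{qT}+\frac{24\,\sigma\sqrt{\beta F}}{\sqrt{qT}}\right).$$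 (ii) (Accelerated SGD, convex.) Suppose $f$ is convex with a minimizer $w^\star$, and $D\ge\|w_1-w^\star\|$, $D>0$. Let $\mathcal A(K)$ be $K$-step accelerated SGD with $\alpha_k=\frac{2}{k+1}$ and $\gamma_k=\frac{k}{4\beta}$: $x_0=y_0=w_1$; for $k=1,\dots,K$ the query is $(1-\alpha_k)y_{k-1}+\alpha_kx_{k-1}$, and with the response $g_k$ one sets $x_k=x_{k-1}-\gamma_kg_k$ and $y_k=(1-\alpha_k)y_{k-1}+\alpha_kx_k$; the output is $y_K$. Let $B_i=\max\{1,\lceil\sigma^2K_i(K_i+1)^2/(12\beta^2D^2)\rceil\}$. Then $$\mathbb E[f(\hat w)-f(w^\star)]\le\inf_{q\in(0,1]}\left(\frac{192(1+2\tau_q)^2\beta D^2}{q^2T^2}+\frac{48\,\sigma D}{\sqrt{qT}}\right).$$ -/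

import Mathlib

open MeasureTheory ProbabilityTheory

namespace AsyncMiniBatch

/-! ### The optimization problem and the stochastic oracle -/

section Problem

variable {E : Type*} [NormedAddCommGroup E] [InnerProductSpace ℝ E] [CompleteSpace E]

/-- `f` is differentiable and its gradient is `β`-Lipschitz. -/
structure IsSmooth (f : E → ℝ) (β : ℝ) : Prop where
  differentiable : Differentiable ℝ f
  lipschitz : ∀ x y, ‖gradient f x - gradient f y‖ ≤ β * ‖x - y‖

/-- A stochastic gradient oracle: the answer to the query `w` is `g w z`, where `z` is drawn
from the law `P`. It is unbiased and has variance at most `σ ^ 2` at every point. -/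
structure IsUnbiasedOracle [MeasurableSpace E] {Z : Type*} [MeasurableSpace Z]
    (f : E → ℝ) (g : E → Z → E) (P : Measure Z) (σ : ℝ) : Prop where
  measurable : Measurable (Function.uncurry g)
  integrable : ∀ w, Integrable (g w) P
  unbiased : ∀ w, ∫ z, g w z ∂P = gradient f w
  integrable_sq : ∀ w, Integrable (fun z => ‖g w z - gradient f w‖ ^ 2) P
  variance_le : ∀ w, ∫ z, ‖g w z - gradient f w‖ ^ 2 ∂P ≤ σ ^ 2

end Problem

/-- `ξ 0, ξ 1, …` are independent random variables on `(Ω, μ)` with common law `P`. -/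
structure IsIIDSample {Ω Z : Type*} [MeasurableSpace Ω] [MeasurableSpace Z]
    (ξ : ℕ → Ω → Z) (P : Measure Z) (μ : Measure Ω) : Prop where
  measurable : ∀ t, Measurable (ξ t)
  law : ∀ t, μ.map (ξ t) = P
  indep : iIndepFun ξ μ

/-- `R` is uniformly distributed on `{1, …, K}`. -/
structure IsUniformIndex {Ω : Type*} [MeasurableSpace Ω] (R : Ω → ℕ) (K : ℕ) (μ : Measure Ω) :
    Prop where
  measurable : Measurable R
  law : ∀ k ∈ Finset.Icc 1 K, μ.real {ω | R ω = k} = 1 / (K : ℝ)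

/-! ### Delays -/

/-- `τ` is a `q`-quantile of the delays `d 1, …, d T`: for `t` uniform on `{1, …, T}`, the event
`d t ≤ τ` has probability at least `q` and the event `τ ≤ d t` has probability at least `1 - q`.
The `1`-quantile is by convention the maximal delay. -/
structure IsDelayQuantile (d : ℕ → ℕ) (T : ℕ) (q τ : ℝ) : Prop where
  nonneg : 0 ≤ τ
  le_prob : q ≤ (((Finset.Icc 1 T).filter fun t => (d t : ℝ) ≤ τ).card : ℝ) / T
  le_prob' : 1 - q ≤ (((Finset.Icc 1 T).filter fun t => τ ≤ (d t : ℝ)).card : ℝ) / T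
  eq_max : q = 1 → τ = (((Finset.Icc 1 T).sup d : ℕ) : ℝ)

/-! ### First-order methods -/

/-- A first-order method with internal states in `S`. It starts in `init`, queries the point
`query s` in the state `s`, moves to `update s v` on receiving the response `v`, and `output s` is
the point it returns if it is stopped in the state `s`. -/
structure FirstOrderMethod (S E : Type*) where
  init : S
  query : S → E
  update : S → E → S
  output : S → E

/-- State of SGD: number of the current step, current iterate, and the iterate selected so far. -/
structure SGDState (E : Type*) where
  step : ℕ
  point : E
  chosen : E

/-- SGD from `w₁` with fixed stepsize `η`: `x₁ = w₁`, `xₖ₊₁ = xₖ - η gₖ`, where `gₖ` is the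
response to the query `xₖ`. It returns the iterate `x_r`; the index `r` is drawn uniformly from
`{1, …, K}` when the method is run for `K` steps. -/
noncomputable def sgd {E : Type*} [AddCommGroup E] [Module ℝ E] (w₁ : E) (η : ℝ) (r : ℕ) :
    FirstOrderMethod (SGDState E) E where
  init := { step := 1, point := w₁, chosen := w₁ }
  query s := s.point
  update s v :=
    { step := s.step + 1
      point := s.point - η • v
      chosen := if s.step = r then s.point else s.chosen }
  output s := s.chosen

/-- State of accelerated SGD: number of the current step, prox center, and aggregated point. -/
structure AccState (E : Type*) where
  step : ℕ
  center : E
  agg : E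

/-- Accelerated SGD (AC-SA) from `w₁` with `αₖ = 2 / (k + 1)` and `γₖ = γ k`:
`x₀ = y₀ = w₁`, the `k`-th query is `(1 - αₖ) yₖ₋₁ + αₖ xₖ₋₁`, and on the response `gₖ`,
`xₖ = xₖ₋₁ - γₖ gₖ` and `yₖ = (1 - αₖ) yₖ₋₁ + αₖ xₖ`. It returns the last `yₖ`. -/
noncomputable def accSGD {E : Type*} [AddCommGroup E] [Module ℝ E] (w₁ : E) (γ : ℝ) :
    FirstOrderMethod (AccState E) E where
  init := { step := 1, center := w₁, agg := w₁ }
  query s :=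
    (1 - 2 / ((s.step : ℝ) + 1)) • s.agg + (2 / ((s.step : ℝ) + 1)) • s.center
  update s v :=
    { step := s.step + 1
      center := s.center - (γ * (s.step : ℝ)) • v
      agg := (1 - 2 / ((s.step : ℝ) + 1)) • s.agg
        + (2 / ((s.step : ℝ) + 1)) • (s.center - (γ * (s.step : ℝ)) • v) }
  output s := s.agg

/-! ### The asynchronous mini-batching sweep -/

/-- State of the sweep between two asynchronous rounds: the epoch `i`, the number `k` of the
current query of the epoch, the round `t_k` at which it was first played, the number `b` of
gradients collected for it, their partial average, the state of the inner method, the list of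
outputs produced so far, and the points `w_t` played so far. -/
structure SweepState (S E : Type*) where
  epoch : ℕ
  index : ℕ
  start : ℕ
  count : ℕ
  acc : E
  inner : S
  outputs : List E
  played : ℕ → E

variable {S E : Type*} [AddCommGroup E] [Module ℝ E]

/-- Initial state, before round `1`. (The value of `played` at rounds that have not
happened is a placeholder.) -/
def sweepInit (A : ℕ → FirstOrderMethod S E) : SweepState S E where
  epoch := 1
  index := 1
  start := 1
  count := 0
  acc := 0
  inner := (A 1).init
  outputs := []
  played := fun _ => 0

/-- One asynchronous round, at time `t`: play the current query, receive the delay `d` and the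
stochastic gradient `grad` at the point played at round `t - d`, keep it if the current query
was already being played at that round, and, once `B i` gradients have been kept, send their
average to the inner method; after `K i` responses, record its output and start the next epoch.
Here `A i` is the fresh copy of the inner method that is run in epoch `i`, and `B i`, `K i`
are positive. -/
noncomputable def sweepRound (A : ℕ → FirstOrderMethod S E) (K B : ℕ → ℕ) (t d : ℕ)
    (grad : E → E) (s : SweepState S E) : SweepState S E :=
  let played := Function.update s.played t ((A s.epoch).query s.inner)
  if s.start + d ≤ t then
    let acc := s.acc + (1 / (B s.epoch : ℝ)) • grad (played (t - d))
    if s.count + 1 < B s.epoch then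
      { s with count := s.count + 1, acc := acc, played := played }
    else
      let inner := (A s.epoch).update s.inner acc
      if s.index < K s.epoch then
        { s with
          index := s.index + 1, start := t + 1, count := 0, acc := 0, inner := inner,
          played := played }
      else
        { epoch := s.epoch + 1
          index := 1
          start := t + 1
          count := 0
          acc := 0
          inner := (A (s.epoch + 1)).init
          outputs := s.outputs ++ [(A s.epoch).output inner]
          played := played }
  else { s with played := played }

/-- State of the sweep after `T` rounds, for the delays `d 1, d 2, …`, where the gradient
received at round `t` is `grad t (w_{t - d t})`. -/
noncomputable def sweep (A : ℕ → FirstOrderMethod S E) (K B : ℕ → ℕ) (d : ℕ → ℕ)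
    (grad : ℕ → E → E) : ℕ → SweepState S E
  | 0 => sweepInit A
  | t + 1 => sweepRound A K B (t + 1) (d (t + 1)) (grad (t + 1)) (sweep A K B d grad t)

/-- The last output produced within `T` rounds, or `w₁` if there is none. -/
noncomputable def sweepOutput (A : ℕ → FirstOrderMethod S E) (K B : ℕ → ℕ) (d : ℕ → ℕ)
    (grad : ℕ → E → E) (w₁ : E) (T : ℕ) : E :=
  (sweep A K B d grad T).outputs.getLastD w₁

/-! ### Parameters -/

/-- Epoch lengths `K i = 2 ^ (i - 1)`, for `i = 1, 2, …`. -/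
def epochLength (i : ℕ) : ℕ := 2 ^ (i - 1)

/-- Batch sizes `max {1, ⌈σ² Kᵢ / (2 β F)⌉}`. -/
noncomputable def batchSGD (σ β F : ℝ) (i : ℕ) : ℕ :=
  max 1 ⌈σ ^ 2 * (epochLength i : ℝ) / (2 * β * F)⌉₊

/-- Batch sizes `max {1, ⌈σ² Kᵢ (Kᵢ + 1)² / (12 β² D²)⌉}`. -/
noncomputable def batchAcc (σ β D : ℝ) (i : ℕ) : ℕ :=
  max 1 ⌈σ ^ 2 * (epochLength i : ℝ) * ((epochLength i : ℝ) + 1) ^ 2 / (12 * β ^ 2 * D ^ 2)⌉₊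

end AsyncMiniBatch

open AsyncMiniBatch

/-! Which rounds feed which query is decided by the delays, epoch lengths and batch sizes alone,
never by the gradients. `exists_schedule` extracts this deterministic schedule, and two facts about
it carry the theorem.

Counting: fix a threshold `θ`. A round of delay at most `θ` is discarded only if it is among the
first `θ` rounds of the current query, so a query consumes at most `B + θ` such rounds. If `e`
epochs are completed, the rounds of delay at most `τ_q`, at least `qT` in number, are covered by `e
+ 1` full epochs: `qT ≤ ∑_{j ≤ e+1} K_j (B_j + τ_q)`. Epoch lengths double, so this sum is
comparable to its last term, and `2 ^ e` is bounded below (`exists_sweepOutput_eq`,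
`IsDelayQuantile.mul_le_sum`). Neither `e` nor the output depends on `q`, hence the infimum over
`q`.

Probability: the batches of an epoch are disjoint sets of rounds, and each query is a function of
the samples in earlier batches. The error of a response is therefore orthogonal to everything
earlier and has second moment at most `σ² / B` (`IsIIDSample.batchMean_error`), so the usual
mini-batch analyses apply despite the delays (`sgd_run_bound`, `accSGD_run_bound`). The batch sizes
keep the noise below the optimization error, which leaves `8βF / 2^e` and `24βD² / 4^e`; `sgd_rate`
and `acc_rate` eliminate `2 ^ e`. -/

namespace AsyncMiniBatch

/-! ### Decoupling the schedule from the inner method -/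

section Schedule

variable {S E : Type*}

/-- State of `M` after `k` responses, when the `j`-th query `x` (counting from `0`) is answered
by `v j x`. -/
def FirstOrderMethod.run (M : FirstOrderMethod S E) (v : ℕ → E → E) : ℕ → S
  | 0 => M.init
  | k + 1 => M.update (M.run v k) (v k (M.query (M.run v k)))

lemma FirstOrderMethod.run_congr (M : FirstOrderMethod S E) {v v' : ℕ → E → E} {k : ℕ}
    (h : ∀ j < k, v j = v' j) : M.run v k = M.run v' k := by
  induction k with
  | zero => rfl
  | succ k ih =>
    simp only [FirstOrderMethod.run]
    rw [ih fun j hj => h j (by omega), h k (by omega)]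

variable [AddCommGroup E] [Module ℝ E]

/-- The sum over the rounds in `J` of the stochastic gradients at `x`, each with weight `1 / B`. -/
noncomputable def batchMean (B : ℕ) (grad : ℕ → E → E) (J : Finset ℕ) (x : E) : E :=
  ∑ t ∈ J, (1 / (B : ℝ)) • grad t x

/-- The batches `J 0, …, J (k - 1)` consist of `B` rounds each and are pairwise disjoint. -/
structure IsBatching (B k : ℕ) (J : ℕ → Finset ℕ) : Prop where
  card : ∀ j < k, (J j).card = B
  disjoint : ∀ i j, i ≠ j → Disjoint (J i) (J j)

/-- Bookkeeping after `t` rounds: `e` epochs are completed, `k` queries of the current epoch are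
answered, and `c` gradients are collected for the current query, first played in round `s`.
`J` lists the rounds that contribute to the queries of the current epoch. -/
structure IsSchedule (K B d : ℕ → ℕ) (t e k s c : ℕ) (J : ℕ → Finset ℕ) : Prop where
  index_lt : k < K (e + 1)
  count_lt : c < B (e + 1)
  start_le : s ≤ t + 1
  le_round : ∀ j, ∀ r ∈ J j, r ≤ t
  batching : IsBatching (B (e + 1)) k J
  card_current : (J k).card = c
  eq_empty : ∀ j, k < j → J j = ∅
  card_le : ∀ θ : ℕ, ((Finset.Icc 1 t).filter fun r => d r ≤ θ).card ≤
    ∑ j ∈ Finset.range e, K (j + 1) * (B (j + 1) + θ) + k * (B (e + 1) + θ) + c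
      + min θ (t + 1 - s)

/-- The state `x` of the sweep is the one described by the schedule. -/
structure Follows (A : ℕ → FirstOrderMethod S E) (K B : ℕ → ℕ) (grad : ℕ → E → E)
    (t e k s c : ℕ) (J J' : ℕ → Finset ℕ) (x : SweepState S E) : Prop where
  epoch : x.epoch = e + 1
  index : x.index = k + 1
  start : x.start = s
  count : x.count = c
  inner : x.inner = (A (e + 1)).run (fun j => batchMean (B (e + 1)) grad (J j)) k
  acc : x.acc = batchMean (B (e + 1)) grad (J k) ((A (e + 1)).query x.inner)
  played : ∀ r, s ≤ r → r ≤ t → x.played r = (A (e + 1)).query x.inner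
  outputs : ∀ w, x.outputs.getLastD w = if e = 0 then w else
    (A e).output ((A e).run (fun j => batchMean (B e) grad (J' j)) (K e))

lemma filter_Icc_succ_card (p : ℕ → Prop) [DecidablePred p] (t : ℕ) :
    ((Finset.Icc 1 (t + 1)).filter p).card
      = ((Finset.Icc 1 t).filter p).card + if p (t + 1) then 1 else 0 := by
  rw [← Finset.insert_Icc_right_eq_Icc_add_one (by omega), Finset.filter_insert]
  split_ifs with h
  · rw [Finset.card_insert_of_notMem (by simp)]
  · simp

/-- The order of quantifiers is the point: the schedule is chosen before the method and the
gradients, so it stays fixed when these become random. `J` belongs to the running epoch and `J'` to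
the last completed one, whose output is the one recorded last. -/
theorem exists_schedule (K B d : ℕ → ℕ) (hK : ∀ i, 0 < K i) (hB : ∀ i, 0 < B i) (t : ℕ) :
    ∃ (e k s c : ℕ) (J J' : ℕ → Finset ℕ), IsSchedule K B d t e k s c J ∧
      (e ≠ 0 → IsBatching (B e) (K e) J') ∧
      ∀ (A : ℕ → FirstOrderMethod S E) (grad : ℕ → E → E),
        Follows A K B grad t e k s c J J' (sweep A K B d grad t) := by
  induction t with
  | zero =>
    refine ⟨0, 0, 1, 0, fun _ => ∅, fun _ => ∅, ⟨hK _, hB _, by simp, by simp, ⟨by simp, by simp⟩,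
      by simp, by simp, by simp⟩, by simp, fun A grad => ?_⟩
    constructor <;> simp [sweep, sweepInit, batchMean, FirstOrderMethod.run]
    omega
  | succ t ih =>
    obtain ⟨e, k, s, c, J, J', hS, hJ', hF⟩ := ih
    by_cases hkeep : s + d (t + 1) ≤ t + 1
    swap
    · refine ⟨e, k, s, c, J, J', ⟨hS.index_lt, hS.count_lt, by have := hS.start_le; omega,
        fun j r hr => (hS.le_round j r hr).trans (by omega), hS.batching, hS.card_current,
        hS.eq_empty, fun θ => ?_⟩, hJ', fun A grad => ?_⟩
      -- A discarded round of delay at most `θ` satisfies `t + 1 < s + θ`, so the term `min θ (t + 1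
      -- - s)` still grows by one and pays for it.
      · have := hS.card_le θ
        rw [filter_Icc_succ_card]
        have := hS.start_le
        split_ifs with h <;> omega
      · have h := hF A grad
        have hs : sweep A K B d grad (t + 1) = { sweep A K B d grad t with
            played := Function.update (sweep A K B d grad t).played (t + 1)
              ((A (e + 1)).query (sweep A K B d grad t).inner) } := by
          simp [sweep, sweepRound, h.start, hkeep, h.epoch]
        rw [hs]
        refine ⟨h.epoch, h.index, h.start, h.count, h.inner, h.acc, fun r h1 h2 => ?_, h.outputs⟩
        simp only [Function.update_apply]
        split_ifs with hr
        · rfl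
        · exact h.played r h1 (by omega)
    -- From here on the gradient of round `t + 1` is kept, so this round joins the batch of the
    -- current query.
    set J₁ := Function.update J k (insert (t + 1) (J k)) with hJ₁
    have hnot : ∀ j, t + 1 ∉ J j := fun j hj => by have := hS.le_round j _ hj; omega
    have hJ₁k : J₁ k = insert (t + 1) (J k) := by simp [hJ₁]
    have hJ₁ne : ∀ j, j ≠ k → J₁ j = J j := fun j hj => by simp [hJ₁, hj]
    have hcard₁ : (J₁ k).card = c + 1 := by
      rw [hJ₁k, Finset.card_insert_of_notMem (hnot k), hS.card_current]
    have hle₁ : ∀ j, ∀ r ∈ J₁ j, r ≤ t + 1 := by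
      intro j r hr
      by_cases hj : j = k
      · subst hj
        rw [hJ₁k, Finset.mem_insert] at hr
        rcases hr with rfl | hr
        · rfl
        · exact (hS.le_round _ _ hr).trans (by omega)
      · rw [hJ₁ne j hj] at hr
        exact (hS.le_round _ _ hr).trans (by omega)
    have hdisj₁ : ∀ i j, i ≠ j → Disjoint (J₁ i) (J₁ j) := by
      intro i j hij
      by_cases hi : i = k
      · subst hi
        rw [hJ₁k, hJ₁ne j (Ne.symm hij), Finset.disjoint_insert_left]
        exact ⟨hnot j, hS.batching.disjoint _ _ hij⟩
      · by_cases hj : j = k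
        · subst hj
          rw [hJ₁k, hJ₁ne i hi, Finset.disjoint_insert_right]
          exact ⟨hnot i, hS.batching.disjoint _ _ hij⟩
        · rw [hJ₁ne i hi, hJ₁ne j hj]
          exact hS.batching.disjoint _ _ hij
    have hrun : ∀ (A : ℕ → FirstOrderMethod S E) (grad : ℕ → E → E),
        (A (e + 1)).run (fun j => batchMean (B (e + 1)) grad (J₁ j)) k
          = (sweep A K B d grad t).inner := by
      intro A grad
      rw [(hF A grad).inner]
      exact (A (e + 1)).run_congr fun j hj => by rw [hJ₁ne j (by omega)]
    -- The kept gradient was evaluated at the current query, because every round from `s` on has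
    -- played that point.
    have hacc : ∀ (A : ℕ → FirstOrderMethod S E) (grad : ℕ → E → E),
        (sweep A K B d grad t).acc + (1 / (B (e + 1) : ℝ)) • grad (t + 1)
          (Function.update (sweep A K B d grad t).played (t + 1)
            ((A (e + 1)).query (sweep A K B d grad t).inner) (t + 1 - d (t + 1)))
          = batchMean (B (e + 1)) grad (J₁ k)
            ((A (e + 1)).query (sweep A K B d grad t).inner) := by
      intro A grad
      have h := hF A grad
      have hp : Function.update (sweep A K B d grad t).played (t + 1)
            ((A (e + 1)).query (sweep A K B d grad t).inner) (t + 1 - d (t + 1))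
          = (A (e + 1)).query (sweep A K B d grad t).inner := by
        simp only [Function.update_apply]
        split_ifs with hr
        · rfl
        · exact h.played _ (by omega) (by omega)
      rw [hp, h.acc, hJ₁k]
      simp only [batchMean]
      rw [Finset.sum_insert (hnot k), add_comm]
    have hcardle : ∀ θ : ℕ, ((Finset.Icc 1 (t + 1)).filter fun r => d r ≤ θ).card ≤
        ∑ j ∈ Finset.range e, K (j + 1) * (B (j + 1) + θ) + k * (B (e + 1) + θ) + (c + 1)
          + min θ (t + 1 - s) := by
      intro θ
      have := hS.card_le θ
      rw [filter_Icc_succ_card]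
      split_ifs <;> omega
    by_cases hc : c + 1 < B (e + 1)
    · refine ⟨e, k, s, c + 1, J₁, J', ⟨hS.index_lt, hc, by omega, hle₁,
        ⟨fun j hj => by rw [hJ₁ne j (by omega), hS.batching.card j hj], hdisj₁⟩, hcard₁,
        fun j hj => by rw [hJ₁ne j (by omega), hS.eq_empty j hj], fun θ => ?_⟩, hJ',
        fun A grad => ?_⟩
      · have := hcardle θ
        omega
      · have h := hF A grad
        have hs : sweep A K B d grad (t + 1) = { sweep A K B d grad t with
            count := c + 1
            acc := batchMean (B (e + 1)) grad (J₁ k)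
              ((A (e + 1)).query (sweep A K B d grad t).inner)
            played := Function.update (sweep A K B d grad t).played (t + 1)
              ((A (e + 1)).query (sweep A K B d grad t).inner) } := by
          rw [← hacc A grad]
          simp [sweep, sweepRound, h.start, hkeep, h.epoch, h.count, hc]
        rw [hs]
        refine ⟨h.epoch, h.index, h.start, rfl, (hrun A grad).symm, rfl, fun r h1 h2 => ?_,
          h.outputs⟩
        simp only [Function.update_apply]
        split_ifs with hr
        · rfl
        · exact h.played r h1 (by omega)
    have hcB : c + 1 = B (e + 1) := by have := hS.count_lt; omega
    have hb₁ : IsBatching (B (e + 1)) (k + 1) J₁ := by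
      refine ⟨fun j hj => ?_, hdisj₁⟩
      by_cases hjk : j = k
      · rw [hjk, hcard₁, hcB]
      · rw [hJ₁ne j hjk, hS.batching.card j (by omega)]
    have hnext : J₁ (k + 1) = ∅ := by rw [hJ₁ne (k + 1) (by omega), hS.eq_empty (k + 1) (by omega)]
    by_cases hk : k + 1 < K (e + 1)
    · refine ⟨e, k + 1, t + 2, 0, J₁, J', ⟨hk, hB _, le_rfl, hle₁, hb₁, ?_,
        fun j hj => by rw [hJ₁ne j (by omega), hS.eq_empty j (by omega)], fun θ => ?_⟩, hJ',
        fun A grad => ?_⟩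
      · rw [hnext, Finset.card_empty]
      -- Closing the query turns `c + 1 + min θ _` into at most `B + θ`; the new start `t + 2`
      -- resets the `min` term to zero.
      · have := hcardle θ
        rw [add_one_mul]
        omega
      · have h := hF A grad
        have hs : sweep A K B d grad (t + 1) = { sweep A K B d grad t with
            index := k + 2
            start := t + 2
            count := 0
            acc := 0
            inner := (A (e + 1)).update (sweep A K B d grad t).inner
              (batchMean (B (e + 1)) grad (J₁ k)
                ((A (e + 1)).query (sweep A K B d grad t).inner))
            played := Function.update (sweep A K B d grad t).played (t + 1)
              ((A (e + 1)).query (sweep A K B d grad t).inner) } := by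
          rw [← hacc A grad]
          simp [sweep, sweepRound, h.start, hkeep, h.epoch, h.count, hc, h.index, hk]
        rw [hs]
        refine ⟨h.epoch, rfl, rfl, rfl, ?_, ?_, fun r h1 h2 => by omega, h.outputs⟩
        · simp only [FirstOrderMethod.run, hrun A grad]
        · rw [hnext]
          simp [batchMean]
    · have hkK : k + 1 = K (e + 1) := by have := hS.index_lt; omega
      refine ⟨e + 1, 0, t + 2, 0, fun _ => ∅, J₁, ⟨hK _, hB _, le_rfl, by simp,
        ⟨by simp, by simp⟩, by simp, by simp, fun θ => ?_⟩, fun _ => hkK ▸ hb₁, fun A grad => ?_⟩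
      · have := hcardle θ
        rw [Finset.sum_range_succ, ← hkK, add_one_mul]
        omega
      · have h := hF A grad
        have hs : sweep A K B d grad (t + 1) =
            { epoch := e + 2
              index := 1
              start := t + 2
              count := 0
              acc := 0
              inner := (A (e + 2)).init
              outputs := (sweep A K B d grad t).outputs ++ [(A (e + 1)).output
                ((A (e + 1)).update (sweep A K B d grad t).inner
                  (batchMean (B (e + 1)) grad (J₁ k)
                    ((A (e + 1)).query (sweep A K B d grad t).inner)))]
              played := Function.update (sweep A K B d grad t).played (t + 1)
                ((A (e + 1)).query (sweep A K B d grad t).inner) } := by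
          rw [← hacc A grad]
          simp [sweep, sweepRound, h.start, hkeep, h.epoch, h.count, hc, h.index, hk]
        rw [hs]
        refine ⟨rfl, rfl, rfl, rfl, rfl, by simp [batchMean], fun r h1 h2 => by omega,
          fun w => ?_⟩
        simp only [List.getLastD_concat, Nat.add_eq_zero_iff, one_ne_zero, and_false, if_false,
          ← hkK, FirstOrderMethod.run, hrun A grad]

/-- The output of the sweep is `w₁`, or the output of a run of the inner method in epoch `e`
along disjoint batches. The numbers `e` and `J` depend only on the delays, and at least
`K 1 + ⋯ + K (e + 1)` batches are needed to use up the rounds with small delays. -/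
theorem exists_sweepOutput_eq (K B d : ℕ → ℕ) (hK : ∀ i, 0 < K i) (hB : ∀ i, 0 < B i) (T : ℕ) :
    ∃ (e : ℕ) (J : ℕ → Finset ℕ), (e ≠ 0 → IsBatching (B e) (K e) J) ∧
      (∀ θ : ℕ, ((Finset.Icc 1 T).filter fun r => d r ≤ θ).card ≤
        ∑ j ∈ Finset.range (e + 1), K (j + 1) * (B (j + 1) + θ)) ∧
      ∀ (A : ℕ → FirstOrderMethod S E) (grad : ℕ → E → E) (w₁ : E),
        sweepOutput A K B d grad w₁ T = if e = 0 then w₁ else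
          (A e).output ((A e).run (fun j => batchMean (B e) grad (J j)) (K e)) := by
  obtain ⟨e, k, s, c, J, J', hS, hJ', hF⟩ := exists_schedule (S := S) (E := E) K B d hK hB T
  refine ⟨e, J', hJ', fun θ => (hS.card_le θ).trans ?_, fun A grad w₁ => (hF A grad).outputs w₁⟩
  -- The unfinished query is charged in full, `c + min θ _ ≤ B + θ`, and the unfinished epoch
  -- likewise. This is why `e + 1` epochs appear.
  have h1 := hS.count_lt
  have h2 : (k + 1) * (B (e + 1) + θ) ≤ K (e + 1) * (B (e + 1) + θ) :=
    Nat.mul_le_mul_right _ hS.index_lt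
  rw [add_one_mul] at h2
  rw [Finset.sum_range_succ]
  omega

end Schedule

/-! ### Smooth functions -/

section Smooth

open scoped RealInnerProductSpace

variable {E : Type*} [NormedAddCommGroup E] [InnerProductSpace ℝ E] [CompleteSpace E]
  {f : E → ℝ} {β : ℝ}

lemma IsSmooth.continuous_gradient (hf : IsSmooth f β) : Continuous (gradient f) := by
  have : LipschitzWith β.toNNReal (gradient f) := LipschitzWith.of_dist_le_mul fun x y => by
    rw [dist_eq_norm, dist_eq_norm]
    exact (hf.lipschitz x y).trans (by gcongr; exact Real.le_coe_toNNReal β)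
  exact this.continuous

lemma IsSmooth.norm_gradient_le (hf : IsSmooth f β) (x : E) :
    ‖gradient f x‖ ≤ ‖gradient f 0‖ + β * ‖x‖ := by
  have h1 := hf.lipschitz x 0
  rw [sub_zero] at h1
  have h2 := norm_sub_norm_le (gradient f x) (gradient f 0)
  linarith

/-- The descent lemma. -/
theorem IsSmooth.le_quadratic (hf : IsSmooth f β) (x y : E) :
    f y ≤ f x + ⟪gradient f x, y - x⟫ + β / 2 * ‖y - x‖ ^ 2 := by
  set v := y - x with hv
  set φ : ℝ → ℝ := fun t => f (x + t • v) - t * ⟪gradient f x, v⟫ - β / 2 * t ^ 2 * ‖v‖ ^ 2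
  have hd : ∀ t, HasDerivAt φ
      (⟪gradient f (x + t • v), v⟫ - ⟪gradient f x, v⟫ - β * t * ‖v‖ ^ 2) t := by
    intro t
    have h1 : HasDerivAt (fun t : ℝ => x + t • v) v t := by
      simpa using ((hasDerivAt_id t).smul_const v).const_add x
    have h2 : HasDerivAt (fun t : ℝ => f (x + t • v)) ⟪gradient f (x + t • v), v⟫ t := by
      have := (hf.differentiable (x + t • v)).hasGradientAt.hasFDerivAt.comp_hasDerivAt t h1
      simp only [InnerProductSpace.toDual_apply_apply] at this
      exact this
    have h3 : HasDerivAt (fun t : ℝ => t * ⟪gradient f x, v⟫) ⟪gradient f x, v⟫ t := by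
      simpa using (hasDerivAt_id t).mul_const ⟪gradient f x, v⟫
    have h4 : HasDerivAt (fun t : ℝ => β / 2 * t ^ 2 * ‖v‖ ^ 2) (β * t * ‖v‖ ^ 2) t := by
      refine (((hasDerivAt_pow 2 t).const_mul (β / 2)).mul_const (‖v‖ ^ 2)).congr_deriv ?_
      simp only [Nat.cast_ofNat, Nat.add_one_sub_one, pow_one]
      ring
    exact (h2.sub h3).sub h4
  -- The derivative is nonpositive by Cauchy–Schwarz and the Lipschitz bound `‖∇f(x + t v) - ∇f(x)‖
  -- ≤ β t ‖v‖`.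
  have hanti : AntitoneOn φ (Set.Icc 0 1) := by
    refine antitoneOn_of_deriv_nonpos (convex_Icc 0 1)
      (fun t _ => (hd t).continuousAt.continuousWithinAt)
      (fun t _ => (hd t).differentiableAt.differentiableWithinAt) fun t ht => ?_
    rw [interior_Icc] at ht
    rw [(hd t).deriv, ← inner_sub_left]
    have h1 := real_inner_le_norm (gradient f (x + t • v) - gradient f x) v
    have h2 := hf.lipschitz (x + t • v) x
    rw [add_sub_cancel_left, norm_smul, Real.norm_of_nonneg ht.1.le] at h2
    have h3 := mul_le_mul_of_nonneg_right h2 (norm_nonneg v)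
    nlinarith
  have h := hanti (Set.left_mem_Icc.2 zero_le_one) (Set.right_mem_Icc.2 zero_le_one) zero_le_one
  simp only [φ, hv, zero_smul, one_smul, add_zero, add_sub_cancel] at h
  linarith

/-- With step size exactly `1 / β` the cross terms `⟪∇f x, N⟫` of the descent lemma cancel. The
bound thus holds pathwise, and only the second moment of the noise enters the SGD analysis. -/
lemma IsSmooth.sub_gradient_step_le (hf : IsSmooth f β) (hβ : 0 < β) (x N : E) :
    f (x - (1 / β) • (gradient f x + N)) ≤
      f x - 1 / (2 * β) * ‖gradient f x‖ ^ 2 + 1 / (2 * β) * ‖N‖ ^ 2 := by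
  have h := hf.le_quadratic x (x - (1 / β) • (gradient f x + N))
  have hv : x - (1 / β) • (gradient f x + N) - x = -((1 / β) • (gradient f x + N)) := by abel
  rw [hv, inner_neg_right, inner_smul_right, inner_add_right, norm_neg, norm_smul, mul_pow,
    norm_add_sq_real, real_inner_self_eq_norm_sq, Real.norm_of_nonneg (by positivity)] at h
  refine h.trans (le_of_eq ?_)
  field_simp
  ring

/-- A noiseless gradient step cannot go below `m`. -/
lemma IsSmooth.norm_gradient_sq_le (hf : IsSmooth f β) (hβ : 0 < β) {m : ℝ} (hm : ∀ x, m ≤ f x)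
    (x : E) : ‖gradient f x‖ ^ 2 ≤ 2 * β * (f x - m) := by
  have h := (hm _).trans (hf.sub_gradient_step_le hβ x 0)
  simp only [norm_zero, ne_eq, OfNat.ofNat_ne_zero, not_false_eq_true, zero_pow, mul_zero,
    add_zero] at h
  have h2 : 1 / (2 * β) * ‖gradient f x‖ ^ 2 ≤ f x - m := by linarith
  rwa [one_div, inv_mul_le_iff₀ (by positivity)] at h2

lemma IsSmooth.gradient_eq_zero (hf : IsSmooth f β) (hβ : 0 < β) {w : E} (hw : ∀ x, f w ≤ f x) :
    gradient f w = 0 := by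
  have := hf.norm_gradient_sq_le hβ hw w
  rw [sub_self, mul_zero] at this
  simpa using this

lemma IsSmooth.sub_min_le (hf : IsSmooth f β) (hβ : 0 < β) {w : E} (hw : ∀ x, f w ≤ f x) (x : E) :
    f x - f w ≤ β / 2 * ‖x - w‖ ^ 2 := by
  have := hf.le_quadratic w x
  rw [hf.gradient_eq_zero hβ hw, inner_zero_left] at this
  linarith

/-- The gradient inequality of a convex function. -/
theorem gradient_inequality (hf : Differentiable ℝ f) (hc : ConvexOn ℝ Set.univ f) (x y : E) :
    f x + ⟪gradient f x, y - x⟫ ≤ f y := by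
  set v := y - x with hv
  have hφ : ConvexOn ℝ Set.univ (fun t : ℝ => f (x + t • v)) := by
    have := hc.comp_affineMap (AffineMap.lineMap (k := ℝ) x y)
    rw [Set.preimage_univ] at this
    have e : (fun t : ℝ => f (x + t • v)) = f ∘ AffineMap.lineMap (k := ℝ) x y := by
      ext t
      simp [AffineMap.lineMap_apply, hv, add_comm]
    rw [e]
    exact this
  have h2 : HasDerivAt (fun t : ℝ => f (x + t • v)) ⟪gradient f x, v⟫ 0 := by
    have h1 : HasDerivAt (fun t : ℝ => x + t • v) v 0 := by
      simpa using ((hasDerivAt_id (0 : ℝ)).smul_const v).const_add x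
    have := (hf (x + (0 : ℝ) • v)).hasGradientAt.hasFDerivAt.comp_hasDerivAt 0 h1
    simp only [InnerProductSpace.toDual_apply_apply] at this
    rw [zero_smul, add_zero] at this
    exact this
  have h := hφ.le_slope_of_hasDerivAt (Set.mem_univ 0) (Set.mem_univ 1) zero_lt_one h2
  simp only [slope_def_field, sub_zero, div_one, one_smul, zero_smul, add_zero, hv,
    add_sub_cancel] at h
  rw [hv]
  linarith

/-- One step of accelerated gradient descent with the perturbed gradient `∇ f z + N`, weighted by
`k (k + 1) / 2`. -/
theorem acc_step (hf : IsSmooth f β) (hβ : 0 < β) (hc : ConvexOn ℝ Set.univ f) (w x y N : E)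
    {k : ℝ} (hk : 1 ≤ k) {z x' y' : E}
    (hz : z = (1 - 2 / (k + 1)) • y + (2 / (k + 1)) • x)
    (hx' : x' = x - (1 / (4 * β) * k) • (gradient f z + N))
    (hy' : y' = (1 - 2 / (k + 1)) • y + (2 / (k + 1)) • x') :
    k * (k + 1) / 2 * (f y' - f w) + 2 * β * ‖x' - w‖ ^ 2 ≤
      (k - 1) * k / 2 * (f y - f w) + 2 * β * ‖x - w‖ ^ 2 - k * ⟪x - w, N⟫
        + k ^ 2 / (4 * β) * ‖N‖ ^ 2 := by
  set G := gradient f z with hG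
  set Δ := x' - x with hΔ
  have hΔ' : G = -((4 * β / k) • Δ) - N := by
    have : Δ = -((1 / (4 * β) * k) • (G + N)) := by rw [hΔ, hx']; abel
    rw [this, smul_neg, smul_smul, show 4 * β / k * (1 / (4 * β) * k) = 1 by field_simp]
    simp
  have h1 := hf.le_quadratic z y'
  -- The query and the new aggregate mix the same `y` with the same weights, so they differ only
  -- through the move of the center.
  have hyz : y' - z = (2 / (k + 1)) • Δ := by
    rw [hy', hz, hΔ, smul_sub]; abel
  rw [hyz, norm_smul, inner_smul_right, Real.norm_of_nonneg (by positivity)] at h1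
  have h2 := gradient_inequality hf.differentiable hc z y
  have h3 := gradient_inequality hf.differentiable hc z w
  rw [← hG] at h1 h2 h3
  have hcomb : (1 - 2 / (k + 1)) * ⟪G, y - z⟫ + 2 / (k + 1) * ⟪G, x - z⟫ = 0 := by
    rw [← inner_smul_right, ← inner_smul_right, ← inner_add_right]
    have : (1 - 2 / (k + 1)) • (y - z) + (2 / (k + 1)) • (x - z) = 0 := by
      have e : (1 - 2 / (k + 1)) • (y - z) + (2 / (k + 1)) • (x - z)
        = ((1 - 2 / (k + 1)) • y + (2 / (k + 1)) • x) - z := by module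
      rw [e, ← hz, sub_self]
    rw [this, inner_zero_right]
  have hxz : ⟪G, x - z⟫ = ⟪G, x - w⟫ + ⟪G, w - z⟫ := by
    rw [← inner_add_right]; congr 1; abel
  have hGw : ⟪G, x - w⟫ = -(4 * β / k) * ⟪Δ, x - w⟫ - ⟪x - w, N⟫ := by
    rw [hΔ', inner_sub_left, inner_neg_left, real_inner_smul_left, real_inner_comm N]; ring
  have hGΔ : ⟪G, Δ⟫ = -(4 * β / k) * ‖Δ‖ ^ 2 - ⟪N, Δ⟫ := by
    rw [hΔ', inner_sub_left, inner_neg_left, real_inner_smul_left, real_inner_self_eq_norm_sq]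
    ring
  have hnorm : ‖x' - w‖ ^ 2 = ‖x - w‖ ^ 2 + 2 * ⟪Δ, x - w⟫ + ‖Δ‖ ^ 2 := by
    have : x' - w = Δ + (x - w) := by rw [hΔ]; abel
    rw [this, norm_add_sq_real]; ring
  -- The weights fit the budget for `‖Δ‖²`: after multiplication by `k`, Young costs `β`, smoothness
  -- at most `β` and the distance term `2β`. Together they use up the `-4β` supplied by the step
  -- size `k / (4β)`.
  have hyoung : -⟪N, Δ⟫ ≤ β / k * ‖Δ‖ ^ 2 + k / (4 * β) * ‖N‖ ^ 2 := by
    have h0 := norm_add_sq_real ((2 * β / k) • Δ) N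
    rw [norm_smul, real_inner_smul_left, Real.norm_of_nonneg (by positivity),
      real_inner_comm N Δ] at h0
    have h00 : 0 ≤ (k / (4 * β)) * ‖(2 * β / k) • Δ + N‖ ^ 2 := by positivity
    rw [h0] at h00
    have e : k / (4 * β) * ((2 * β / k * ‖Δ‖) ^ 2 + 2 * (2 * β / k * ⟪N, Δ⟫) + ‖N‖ ^ 2)
      = β / k * ‖Δ‖ ^ 2 + k / (4 * β) * ‖N‖ ^ 2 + ⟪N, Δ⟫ := by field_simp; ring
    linarith
  have hk0 : 0 < k + 1 := by linarith
  have e1 : k * (k + 1) / 2 * (f z + 2 / (k + 1) * ⟪G, Δ⟫ + β / 2 * (2 / (k + 1) * ‖Δ‖) ^ 2)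
      = k * (k + 1) / 2 * f z + k * ⟪G, Δ⟫ + β * (k / (k + 1)) * ‖Δ‖ ^ 2 := by
    field_simp
  have i1 := mul_le_mul_of_nonneg_left h1 (by positivity : 0 ≤ k * (k + 1) / 2)
  rw [e1] at i1
  have i2 := mul_le_mul_of_nonneg_left h2
    (by have : 0 ≤ k - 1 := by linarith
        positivity : 0 ≤ (k - 1) * k / 2)
  have i3 := mul_le_mul_of_nonneg_left h3 (by positivity : 0 ≤ k)
  have e4 : (k - 1) * k / 2 * ⟪G, y - z⟫ + k * ⟪G, x - z⟫ = 0 := by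
    have : (k - 1) * k / 2 * ⟪G, y - z⟫ + k * ⟪G, x - z⟫ = k * (k + 1) / 2 *
        ((1 - 2 / (k + 1)) * ⟪G, y - z⟫ + 2 / (k + 1) * ⟪G, x - z⟫) := by field_simp; ring
    rw [this, hcomb, mul_zero]
  have e5 : k * ⟪G, x - w⟫ = -(4 * β) * ⟪Δ, x - w⟫ - k * ⟪x - w, N⟫ := by
    rw [hGw]; field_simp
  have e6 : k * ⟪G, Δ⟫ = -(4 * β) * ‖Δ‖ ^ 2 + k * -⟪N, Δ⟫ := by
    rw [hGΔ, mul_sub, mul_neg]; field_simp; rfl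
  have i6 := mul_le_mul_of_nonneg_left hyoung (by positivity : 0 ≤ k)
  have e7 : k * (β / k * ‖Δ‖ ^ 2 + k / (4 * β) * ‖N‖ ^ 2)
      = β * ‖Δ‖ ^ 2 + k ^ 2 / (4 * β) * ‖N‖ ^ 2 := by field_simp
  have i8 : β * (k / (k + 1)) * ‖Δ‖ ^ 2 ≤ β * 1 * ‖Δ‖ ^ 2 := by
    gcongr
    rw [div_le_one hk0]
    linarith
  rw [hnorm]
  rw [hxz] at e4
  linarith

end Smooth
/-! ### Independent oracle answers -/

section Oracle

open scoped RealInnerProductSpace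

variable {Ω Z : Type*} [mZ : MeasurableSpace Z]

/-- The σ-algebra generated by the samples with index in `U`. -/
abbrev sampleSigma (ξ : ℕ → Ω → Z) (U : Set ℕ) : MeasurableSpace Ω :=
  ⨆ t ∈ U, mZ.comap (ξ t)

lemma sampleSigma_mono (ξ : ℕ → Ω → Z) {U V : Set ℕ} (h : U ⊆ V) :
    sampleSigma ξ U ≤ sampleSigma ξ V :=
  biSup_mono h

lemma measurable_sample (ξ : ℕ → Ω → Z) {U : Set ℕ} {t : ℕ} (ht : t ∈ U) :
    Measurable[sampleSigma ξ U] (ξ t) :=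
  Measurable.mono (comap_measurable (ξ t))
    (le_iSup₂ (f := fun t (_ : t ∈ U) => mZ.comap (ξ t)) t ht) le_rfl

lemma IsUnbiasedOracle.measurable_error {E : Type*} [NormedAddCommGroup E]
    [InnerProductSpace ℝ E] [CompleteSpace E] [MeasurableSpace E] [BorelSpace E]
    [SecondCountableTopology E] {f : E → ℝ} {β σ : ℝ} {g : E → Z → E} {P : Measure Z}
    (hg : IsUnbiasedOracle f g P σ) (hf : IsSmooth f β)
    {m : MeasurableSpace Ω} {X : Ω → E} {ζ : Ω → Z} (hX : Measurable[m] X) (hζ : Measurable[m] ζ) :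
    Measurable[m] fun ω => g (X ω) (ζ ω) - gradient f (X ω) :=
  (hg.measurable.comp (hX.prodMk hζ)).sub (hf.continuous_gradient.measurable.comp hX)

variable [mΩ : MeasurableSpace Ω] {μ : Measure Ω}

lemma integrable_inner_of_memLp {E : Type*} [NormedAddCommGroup E] [InnerProductSpace ℝ E]
    {X Y : Ω → E} (hX : MemLp X 2 μ) (hY : MemLp Y 2 μ) :
    Integrable (fun ω => ⟪X ω, Y ω⟫) μ :=
  Integrable.mono (hX.norm.integrable_mul hY.norm)
    (hX.aestronglyMeasurable.inner hY.aestronglyMeasurable) (.of_forall fun ω => by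
      simpa using norm_inner_le_norm (𝕜 := ℝ) (X ω) (Y ω))

variable {E : Type*} [NormedAddCommGroup E] [InnerProductSpace ℝ E] [CompleteSpace E]
  [MeasurableSpace E] [BorelSpace E] [SecondCountableTopology E]
  {f : E → ℝ} {β σ : ℝ} {g : E → Z → E} {P : Measure Z} {ξ : ℕ → Ω → Z}

lemma IsIIDSample.sampleSigma_le (hξ : IsIIDSample ξ P μ) (U : Set ℕ) : sampleSigma ξ U ≤ mΩ :=
  iSup₂_le fun t _ => (hξ.measurable t).comap_le

/-- Independence is used by sets of rounds, not along time: any sample outside `U` is fresh for a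
function of the samples in `U`. -/
lemma IsIIDSample.indepFun_of_notMem (hξ : IsIIDSample ξ P μ) {U : Set ℕ} {t : ℕ} (ht : t ∉ U)
    {𝓨 : Type*} [MeasurableSpace 𝓨] {Y : Ω → 𝓨} (hY : Measurable[sampleSigma ξ U] Y) :
    IndepFun Y (ξ t) μ := by
  have h := indep_iSup_of_disjoint (fun t => (hξ.measurable t).comap_le) hξ.indep
    (Set.disjoint_singleton_right.2 ht)
  rw [IndepFun_iff_Indep]
  simp only [Set.mem_singleton_iff, iSup_iSup_eq_left] at h
  exact indep_of_indep_of_le_left h hY.comap_le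

variable [IsProbabilityMeasure μ]

/-- At a random point that is independent of the answer, the oracle has variance at most `σ ^ 2`
and is uncorrelated with whatever the answer is independent of. -/
theorem IsUnbiasedOracle.error_of_indepFun (hg : IsUnbiasedOracle f g P σ) (hf : IsSmooth f β)
    {X H : Ω → E} {ζ : Ω → Z} (hX : Measurable X) (hH : Measurable H) (hζ : Measurable ζ)
    (hlaw : μ.map ζ = P) (hind : IndepFun (fun ω => (X ω, H ω)) ζ μ) :
    MemLp (fun ω => g (X ω) (ζ ω) - gradient f (X ω)) 2 μ ∧
    ∫ ω, ‖g (X ω) (ζ ω) - gradient f (X ω)‖ ^ 2 ∂μ ≤ σ ^ 2 ∧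
    (MemLp H 2 μ → ∫ ω, ⟪H ω, g (X ω) (ζ ω) - gradient f (X ω)⟫ ∂μ = 0) := by
  have hP : IsProbabilityMeasure P := hlaw ▸ Measure.isProbabilityMeasure_map hζ.aemeasurable
  have hXH : Measurable fun ω => (X ω, H ω) := hX.prodMk hH
  set ν := μ.map fun ω => (X ω, H ω) with hν
  have hνP : IsProbabilityMeasure ν := Measure.isProbabilityMeasure_map hXH.aemeasurable
  -- Under the product law, Fubini freezes the query point, and the oracle assumptions apply to each
  -- fixed point.
  have hmap : μ.map (fun ω => ((X ω, H ω), ζ ω)) = ν.prod P := by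
    rw [(indepFun_iff_map_prod_eq_prod_map_map hXH.aemeasurable hζ.aemeasurable).1 hind, hlaw]
  have hpm : Measurable fun ω => ((X ω, H ω), ζ ω) := hXH.prodMk hζ
  have hδ : Measurable fun p : (E × E) × Z => g p.1.1 p.2 - gradient f p.1.1 :=
    hg.measurable_error hf (measurable_fst.fst) measurable_snd
  have hsq : Integrable (fun p : (E × E) × Z => ‖g p.1.1 p.2 - gradient f p.1.1‖ ^ 2)
      (ν.prod P) := by
    have hm : AEStronglyMeasurable (fun p : (E × E) × Z => ‖g p.1.1 p.2 - gradient f p.1.1‖ ^ 2)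
      (ν.prod P) := (hδ.norm.pow_const 2).aestronglyMeasurable
    rw [integrable_prod_iff hm]
    refine ⟨.of_forall fun p => hg.integrable_sq p.1, ?_⟩
    -- The variance bound is uniform in the point, so no moment of `X` is needed.
    refine Integrable.of_bound hm.norm.integral_prod_right' (σ ^ 2) (.of_forall fun p => ?_)
    rw [Real.norm_of_nonneg (integral_nonneg fun z => norm_nonneg _)]
    simpa using hg.variance_le p.1
  have hsq' : Integrable (fun ω => ‖g (X ω) (ζ ω) - gradient f (X ω)‖ ^ 2) μ := by
    rw [← hmap] at hsq
    exact hsq.comp_measurable hpm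
  have hmem : MemLp (fun ω => g (X ω) (ζ ω) - gradient f (X ω)) 2 μ :=
    (memLp_two_iff_integrable_sq_norm (hg.measurable_error hf hX hζ).aestronglyMeasurable).2 hsq'
  refine ⟨hmem, ?_, fun hH2 => ?_⟩
  · have h1 : ∫ ω, ‖g (X ω) (ζ ω) - gradient f (X ω)‖ ^ 2 ∂μ
        = ∫ p, ‖g p.1.1 p.2 - gradient f p.1.1‖ ^ 2 ∂(ν.prod P) := by
      rw [← hmap, integral_map hpm.aemeasurable (hδ.norm.pow_const 2).aestronglyMeasurable]
    rw [h1, integral_prod _ hsq]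
    calc _ ≤ ∫ p, σ ^ 2 ∂ν :=
          integral_mono hsq.integral_prod_left (integrable_const _) fun p => hg.variance_le p.1
      _ = σ ^ 2 := by simp
  · have hm : Measurable fun p : (E × E) × Z => ⟪p.1.2, g p.1.1 p.2 - gradient f p.1.1⟫ :=
      (measurable_fst.snd).inner hδ
    have hi : Integrable (fun p : (E × E) × Z => ⟪p.1.2, g p.1.1 p.2 - gradient f p.1.1⟫)
        (ν.prod P) := by
      rw [← hmap, integrable_map_measure hm.aestronglyMeasurable hpm.aemeasurable]
      exact integrable_inner_of_memLp hH2 hmem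
    have h1 : ∫ ω, ⟪H ω, g (X ω) (ζ ω) - gradient f (X ω)⟫ ∂μ
        = ∫ p, ⟪p.1.2, g p.1.1 p.2 - gradient f p.1.1⟫ ∂(ν.prod P) := by
      rw [← hmap, integral_map hpm.aemeasurable hm.aestronglyMeasurable]
    rw [h1, integral_prod _ hi]
    refine integral_eq_zero_of_ae (.of_forall fun p => ?_)
    have hint : Integrable (fun z => g p.1 z - gradient f p.1) P :=
      (hg.integrable p.1).sub (integrable_const _)
    simp only [Pi.zero_apply]
    rw [integral_inner hint, integral_sub (hg.integrable p.1) (integrable_const _),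
      hg.unbiased p.1]
    simp

/-- The error of a batch of `B` answers at a point that does not depend on these answers. -/
theorem IsIIDSample.batchMean_error (hξ : IsIIDSample ξ P μ) (hg : IsUnbiasedOracle f g P σ)
    (hf : IsSmooth f β) {U : Set ℕ} {B : ℕ} (hB : 0 < B) {J : Finset ℕ} (hJ : J.card = B)
    (hUJ : Disjoint U (J : Set ℕ)) {X : Ω → E} (hX : Measurable[sampleSigma ξ U] X) :
    Measurable[sampleSigma ξ (U ∪ J)]
      (fun ω => batchMean B (fun t w => g w (ξ t ω)) J (X ω) - gradient f (X ω)) ∧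
    MemLp (fun ω => batchMean B (fun t w => g w (ξ t ω)) J (X ω) - gradient f (X ω)) 2 μ ∧
    ∫ ω, ‖batchMean B (fun t w => g w (ξ t ω)) J (X ω) - gradient f (X ω)‖ ^ 2 ∂μ
      ≤ σ ^ 2 / B ∧
    ∀ H : Ω → E, Measurable[sampleSigma ξ U] H → MemLp H 2 μ →
      ∫ ω, ⟪H ω, batchMean B (fun t w => g w (ξ t ω)) J (X ω) - gradient f (X ω)⟫ ∂μ = 0 := by
  set δ : ℕ → Ω → E := fun t ω => g (X ω) (ξ t ω) - gradient f (X ω) with hδ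
  have key : ∀ I : Finset ℕ, Disjoint U (I : Set ℕ) →
      Measurable[sampleSigma ξ (U ∪ I)] (fun ω => ∑ t ∈ I, δ t ω) ∧
      MemLp (fun ω => ∑ t ∈ I, δ t ω) 2 μ ∧
      ∫ ω, ‖∑ t ∈ I, δ t ω‖ ^ 2 ∂μ ≤ I.card * σ ^ 2 ∧
      ∀ H : Ω → E, Measurable[sampleSigma ξ U] H → MemLp H 2 μ →
        ∫ ω, ⟪H ω, ∑ t ∈ I, δ t ω⟫ ∂μ = 0 := by
    intro I
    induction I using Finset.induction_on with
    | empty => simp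
    | insert r I hr ih =>
      intro hd
      rw [Finset.coe_insert, Set.disjoint_insert_right] at hd
      obtain ⟨hm, h2, hv, h0⟩ := ih hd.2
      have hrU : r ∉ U ∪ (I : Set ℕ) := by simp [hd.1, hr]
      -- Applied with `H` the partial sum over `I`, this removes the cross term in the variance;
      -- with the given `H` it preserves orthogonality to the past.
      have herr : ∀ H : Ω → E, Measurable[sampleSigma ξ (U ∪ I)] H → MemLp (δ r) 2 μ ∧
          ∫ ω, ‖δ r ω‖ ^ 2 ∂μ ≤ σ ^ 2 ∧ (MemLp H 2 μ → ∫ ω, ⟪H ω, δ r ω⟫ ∂μ = 0) :=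
        fun H hH => by
          have hX' := hX.mono (sampleSigma_mono ξ (Set.subset_union_left (t := (I : Set ℕ)))) le_rfl
          exact hg.error_of_indepFun hf (hX'.mono (hξ.sampleSigma_le _) le_rfl)
            (hH.mono (hξ.sampleSigma_le _) le_rfl) (hξ.measurable r) (hξ.law r)
            (hξ.indepFun_of_notMem hrU (hX'.prodMk hH))
      obtain ⟨hδ2, hδv, hδ0⟩ := herr _ hm
      simp only [Finset.sum_insert hr]
      refine ⟨?_, hδ2.add h2, ?_, fun H hH hH2 => ?_⟩
      · refine Measurable.add ?_ (hm.mono (sampleSigma_mono ξ ?_) le_rfl)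
        · refine hg.measurable_error hf (hX.mono (sampleSigma_mono ξ ?_) le_rfl)
            (measurable_sample ξ (by simp))
          exact Set.subset_union_left
        · exact Set.union_subset_union_right U (by simp)
      · have hin := integrable_inner_of_memLp h2 hδ2
        have hsum : ∫ ω, ‖δ r ω + ∑ t ∈ I, δ t ω‖ ^ 2 ∂μ = ∫ ω, ‖δ r ω‖ ^ 2 ∂μ
            + 2 * ∫ ω, ⟪∑ t ∈ I, δ t ω, δ r ω⟫ ∂μ + ∫ ω, ‖∑ t ∈ I, δ t ω‖ ^ 2 ∂μ := by
          have hs : Integrable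
              (fun ω => ‖δ r ω‖ ^ 2 + 2 * ⟪∑ t ∈ I, δ t ω, δ r ω⟫) μ :=
            hδ2.integrable_norm_pow'.add (hin.const_mul 2)
          rw [← integral_const_mul, ← integral_add hδ2.integrable_norm_pow' (hin.const_mul 2),
            ← integral_add hs h2.integrable_norm_pow']
          refine integral_congr_ae (.of_forall fun ω => ?_)
          simp only [norm_add_sq_real, real_inner_comm (δ r ω)]
        rw [hsum, hδ0 h2, Finset.card_insert_of_notMem hr]
        push_cast
        linarith
      · simp only [inner_add_right]
        rw [integral_add (integrable_inner_of_memLp hH2 hδ2) (integrable_inner_of_memLp hH2 h2),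
          h0 H hH hH2, (herr H (hH.mono (sampleSigma_mono ξ Set.subset_union_left) le_rfl)).2.2 hH2,
          add_zero]
  have hB' : (B : ℝ) ≠ 0 := by positivity
  have heq : (fun ω => batchMean B (fun t w => g w (ξ t ω)) J (X ω) - gradient f (X ω))
      = fun ω => (1 / (B : ℝ)) • ∑ t ∈ J, δ t ω := by
    ext1 ω
    simp only [batchMean, hδ, Finset.sum_sub_distrib, Finset.sum_const, hJ, smul_sub,
      Finset.smul_sum]
    rw [← Nat.cast_smul_eq_nsmul ℝ, smul_smul, one_div, inv_mul_cancel₀ hB', one_smul]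
  obtain ⟨hm, h2, hv, h0⟩ := key J hUJ
  have heq' : ∀ ω, batchMean B (fun t w => g w (ξ t ω)) J (X ω) - gradient f (X ω)
      = (1 / (B : ℝ)) • ∑ t ∈ J, δ t ω := fun ω => congrFun heq ω
  simp only [heq']
  refine ⟨hm.const_smul _, h2.const_smul _, ?_, fun H hH hH2 => ?_⟩
  · simp only [norm_smul, mul_pow]
    rw [integral_const_mul, Real.norm_of_nonneg (by positivity)]
    rw [hJ] at hv
    calc (1 / (B : ℝ)) ^ 2 * ∫ ω, ‖∑ t ∈ J, δ t ω‖ ^ 2 ∂μ ≤ (1 / (B : ℝ)) ^ 2 * (B * σ ^ 2) := by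
          gcongr
      _ = σ ^ 2 / B := by field_simp
  · simp only [inner_smul_right]
    rw [integral_const_mul, h0 H hH hH2, mul_zero]

end Oracle
/-! ### Runs of the two methods along disjoint batches -/

section Runs

open scoped RealInnerProductSpace

/-- Iterates of SGD when the `j`-th query `x` (counting from `0`) is answered by `v j x`. -/
noncomputable def sgdPoint {E : Type*} [AddCommGroup E] [Module ℝ E] (w₁ : E) (η : ℝ)
    (v : ℕ → E → E) : ℕ → E
  | 0 => w₁
  | k + 1 => sgdPoint w₁ η v k - η • v k (sgdPoint w₁ η v k)

/-- The trajectory does not depend on the drawn index, which merely selects a point of it. The shift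
`r - 1` arises because `sgdPoint` counts from `0`. -/
lemma sgd_run {E : Type*} [AddCommGroup E] [Module ℝ E] (w₁ : E) (η : ℝ) (r : ℕ)
    (v : ℕ → E → E) (k : ℕ) :
    (sgd w₁ η r).run v k = ⟨k + 1, sgdPoint w₁ η v k,
      if r ∈ Finset.Icc 1 k then sgdPoint w₁ η v (r - 1) else w₁⟩ := by
  induction k with
  | zero => simp [FirstOrderMethod.run, sgd, sgdPoint]
  | succ k ih =>
    simp only [FirstOrderMethod.run, ih]
    simp only [sgd, sgdPoint, Finset.mem_Icc, SGDState.mk.injEq, true_and]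
    by_cases hr : k + 1 = r
    · subst hr
      simp
    · rw [if_neg hr]
      by_cases h : 1 ≤ r ∧ r ≤ k
      · rw [if_pos h, if_pos ⟨h.1, by omega⟩]
      · rw [if_neg h, if_neg (by omega)]

lemma accSGD_run_step {E : Type*} [AddCommGroup E] [Module ℝ E] (w₁ : E) (γ : ℝ)
    (v : ℕ → E → E) (k : ℕ) : ((accSGD w₁ γ).run v k).step = k + 1 := by
  induction k with
  | zero => rfl
  | succ k ih => simp only [FirstOrderMethod.run]; simp only [accSGD] at ih ⊢; rw [ih]

/-- The rounds in the first `k` batches. -/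
def usedRounds (J : ℕ → Finset ℕ) (k : ℕ) : Set ℕ := {t | ∃ j < k, t ∈ J j}

lemma usedRounds_succ (J : ℕ → Finset ℕ) (k : ℕ) :
    usedRounds J (k + 1) = usedRounds J k ∪ (J k : Set ℕ) := by
  ext t
  simp only [usedRounds, Set.mem_ofPred_eq, Set.mem_union, Finset.mem_coe, Nat.lt_succ_iff_lt_or_eq,
    or_and_right, exists_or, exists_eq_left]

lemma IsBatching.disjoint_usedRounds {B K : ℕ} {J : ℕ → Finset ℕ} (hJ : IsBatching B K J) (k : ℕ) :
    Disjoint (usedRounds J k) (J k : Set ℕ) := by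
  rw [Set.disjoint_left]
  rintro t ⟨j, hj, ht⟩ ht'
  exact Finset.disjoint_left.1 (hJ.disjoint j k hj.ne) ht ht'

variable {Ω Z : Type*} [mΩ : MeasurableSpace Ω] [mZ : MeasurableSpace Z] {μ : Measure Ω}

/-- The mean of `Y R` for a uniform index `R` that is independent of the variables `Y k`. -/
theorem IsUniformIndex.integral_eq [IsProbabilityMeasure μ] {R : Ω → ℕ} {K : ℕ} (hK : 0 < K)
    (hR : IsUniformIndex R K μ) {Y : ℕ → Ω → ℝ} (hY : ∀ k ∈ Finset.Icc 1 K, Integrable (Y k) μ)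
    (hind : ∀ k ∈ Finset.Icc 1 K, IndepFun R (Y k) μ) {W : Ω → ℝ}
    (hW : ∀ ω, R ω ∈ Finset.Icc 1 K → W ω = Y (R ω) ω) :
    Integrable W μ ∧ ∫ ω, W ω ∂μ = (1 / (K : ℝ)) * ∑ k ∈ Finset.Icc 1 K, ∫ ω, Y k ω ∂μ := by
  have hset : ∀ k, MeasurableSet {ω | R ω = k} := fun k => hR.measurable (measurableSet_singleton k)
  -- The `K` prescribed atoms of mass `1 / K` exhaust the probability.
  have hae : ∀ᵐ ω ∂μ, R ω ∈ Finset.Icc 1 K := by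
    have hunion : {ω | R ω ∈ Finset.Icc 1 K} = ⋃ k ∈ Finset.Icc 1 K, {ω | R ω = k} := by
      ext ω; simp
    have hm : MeasurableSet {ω | R ω ∈ Finset.Icc 1 K} := by
      rw [hunion]; exact Finset.measurableSet_biUnion _ fun k _ => hset k
    have h1 : μ.real {ω | R ω ∈ Finset.Icc 1 K} = 1 := by
      rw [hunion, measureReal_biUnion_finset _ fun k _ => hset k, Finset.sum_congr rfl hR.law]
      · simp [hK.ne']
      · intro i _ j _ hij
        exact Set.disjoint_left.2 fun ω h1 h2 => hij (h1.symm.trans h2)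
    rw [ae_iff]
    have h2 := probReal_compl_eq_one_sub (μ := μ) hm
    rw [h1, sub_self, measureReal_eq_zero_iff] at h2
    exact h2
  set ind : ℕ → Ω → ℝ := fun k => {ω | R ω = k}.indicator 1 with hind_def
  have hWae : W =ᵐ[μ] fun ω => ∑ k ∈ Finset.Icc 1 K, ind k ω * Y k ω := by
    filter_upwards [hae] with ω hω
    rw [hW ω hω, Finset.sum_eq_single_of_mem (R ω) hω]
    · simp [hind_def]
    · intro k _ hk
      simp [hind_def, hk.symm]
  have hindm : ∀ k, Integrable (ind k) μ := fun k =>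
    (integrable_const (1 : ℝ)).indicator (hset k)
  have hindep : ∀ k ∈ Finset.Icc 1 K, IndepFun (ind k) (Y k) μ := fun k hk => by
    have : ind k = (({k} : Set ℕ).indicator 1) ∘ R := by
      ext ω; rfl
    rw [this]
    exact (hind k hk).comp (φ := ({k} : Set ℕ).indicator (1 : ℕ → ℝ)) (ψ := id)
      (measurable_of_countable _) measurable_id
  have hint : ∀ k ∈ Finset.Icc 1 K, Integrable (fun ω => ind k ω * Y k ω) μ := fun k hk =>
    (hindep k hk).integrable_mul (hindm k) (hY k hk)
  refine ⟨(integrable_finsetSum _ hint).congr hWae.symm, ?_⟩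
  rw [integral_congr_ae hWae, integral_finsetSum _ hint, Finset.mul_sum]
  refine Finset.sum_congr rfl fun k hk => ?_
  rw [(hindep k hk).integral_fun_mul_eq_mul_integral (hindm k).aestronglyMeasurable
    (hY k hk).aestronglyMeasurable]
  congr 1
  rw [integral_indicator_one (hset k), hR.law k hk]

variable {E : Type*} [NormedAddCommGroup E] [InnerProductSpace ℝ E] [CompleteSpace E]
  {f : E → ℝ} {β σ : ℝ} [IsProbabilityMeasure μ]

lemma IsSmooth.memLp_gradient (hf : IsSmooth f β) (hβ : 0 < β) {X : Ω → E} (hX : MemLp X 2 μ) :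
    MemLp (fun ω => gradient f (X ω)) 2 μ := by
  have h1 : MemLp (fun ω => β * ‖X ω‖) 2 μ := hX.norm.const_mul β
  have h2 : MemLp (fun _ : Ω => ‖gradient f 0‖) 2 μ := memLp_const _
  refine MemLp.of_le (g := fun ω => ‖gradient f 0‖ + β * ‖X ω‖) (h2.add h1)
    (hf.continuous_gradient.comp_aestronglyMeasurable hX.aestronglyMeasurable)
    (.of_forall fun ω => ?_)
  rw [Real.norm_of_nonneg (by positivity)]
  exact hf.norm_gradient_le (X ω)

/-- The nonnegative function `f - m` is dominated by the quadratic from the descent lemma at `0`. -/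
lemma IsSmooth.integrable_comp (hf : IsSmooth f β) {m : ℝ} (hm : ∀ x, m ≤ f x)
    {X : Ω → E} (hX : MemLp X 2 μ) : Integrable (fun ω => f (X ω)) μ := by
  have h : Integrable (fun ω => f (X ω) - m) μ := by
    have hb : Integrable (fun ω => (f 0 - m) + ⟪gradient f 0, X ω⟫ + β / 2 * ‖X ω‖ ^ 2) μ :=
      ((integrable_const _).add (integrable_inner_of_memLp (memLp_const _) hX)).add
        (hX.integrable_norm_pow'.const_mul _)
    refine hb.mono' ((hf.differentiable.continuous.comp_aestronglyMeasurable
      hX.aestronglyMeasurable).sub aestronglyMeasurable_const) (.of_forall fun ω => ?_)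
    rw [Real.norm_of_nonneg (sub_nonneg.2 (hm _))]
    have := hf.le_quadratic 0 (X ω)
    rw [sub_zero] at this
    linarith
  exact (h.add (integrable_const m)).congr (.of_forall fun ω => sub_add_cancel _ _)

variable [MeasurableSpace E] [BorelSpace E] [SecondCountableTopology E]
  {g : E → Z → E} {P : Measure Z} {ξ : ℕ → Ω → Z} {B K : ℕ} {J : ℕ → Finset ℕ}

/-- Adaptedness to the rounds of earlier batches is what makes the next batch fresh; square
integrability licenses the expectations taken later. -/
lemma sgdPoint_regular (hξ : IsIIDSample ξ P μ) (hg : IsUnbiasedOracle f g P σ)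
    (hf : IsSmooth f β) (hβ : 0 < β) (hB : 0 < B) (hJ : IsBatching B K J) (w₁ : E) (η : ℝ)
    {k : ℕ} (hk : k ≤ K) :
    Measurable[sampleSigma ξ (usedRounds J k)] (fun ω => sgdPoint w₁ η
      (fun j => batchMean B (fun t w => g w (ξ t ω)) (J j)) k) ∧
    MemLp (fun ω => sgdPoint w₁ η
      (fun j => batchMean B (fun t w => g w (ξ t ω)) (J j)) k) 2 μ := by
  induction k with
  | zero => exact ⟨measurable_const, memLp_const _⟩
  | succ k ih =>
    obtain ⟨hm, h2⟩ := ih (by omega)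
    obtain ⟨hN, hN2, -, -⟩ := hξ.batchMean_error hg hf hB (hJ.card k (by omega))
      (hJ.disjoint_usedRounds k) hm
    have hm' := hm.mono (sampleSigma_mono ξ (Set.subset_union_left (t := (J k : Set ℕ)))) le_rfl
    have hG' := hf.continuous_gradient.measurable.comp hm'
    rw [usedRounds_succ]
    constructor
    · convert hm'.sub ((hN.add hG').const_smul η) using 2 with ω
      simp only [sgdPoint, Pi.sub_apply, Pi.smul_apply, Pi.add_apply, Function.comp_apply,
        sub_add_cancel]
    · convert h2.sub ((hN2.add (hf.memLp_gradient hβ h2)).const_smul η) using 2 with ω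
      simp only [sgdPoint, Pi.sub_apply, Pi.smul_apply, Pi.add_apply,
        sub_add_cancel]

/-- The average squared gradient norm along mini-batch SGD with step size `1 / β`. -/
theorem sum_integral_gradient_sq_le (hξ : IsIIDSample ξ P μ) (hg : IsUnbiasedOracle f g P σ)
    (hf : IsSmooth f β) (hβ : 0 < β) (hB : 0 < B) (hJ : IsBatching B K J) (w₁ : E) {m : ℝ}
    (hm : ∀ x, m ≤ f x) :
    ∑ k ∈ Finset.range K, ∫ ω, ‖gradient f (sgdPoint w₁ (1 / β)
      (fun j => batchMean B (fun t w => g w (ξ t ω)) (J j)) k)‖ ^ 2 ∂μ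
      ≤ 2 * β * (f w₁ - m) + K * (σ ^ 2 / B) := by
  set x : ℕ → Ω → E := fun k ω => sgdPoint w₁ (1 / β)
    (fun j => batchMean B (fun t w => g w (ξ t ω)) (J j)) k with hx
  have key : ∀ k ≤ K, ∑ j ∈ Finset.range k, ∫ ω, ‖gradient f (x j ω)‖ ^ 2 ∂μ
      ≤ 2 * β * (f w₁ - ∫ ω, f (x k ω) ∂μ) + k * (σ ^ 2 / B) := by
    intro k hk
    induction k with
    | zero => simp [hx, sgdPoint]
    | succ k ih =>
      obtain ⟨hxm, hx2⟩ := sgdPoint_regular hξ hg hf hβ hB hJ w₁ (1 / β) (k := k) (by omega)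
      obtain ⟨-, hx2'⟩ := sgdPoint_regular hξ hg hf hβ hB hJ w₁ (1 / β) hk
      obtain ⟨-, hN2, hNv, -⟩ := hξ.batchMean_error hg hf hB (hJ.card k (by omega))
        (hJ.disjoint_usedRounds k) hxm
      set N : Ω → E := fun ω => batchMean B (fun t w => g w (ξ t ω)) (J k) (x k ω)
        - gradient f (x k ω) with hN
      have hi0 : Integrable (fun ω => f (x k ω)) μ := hf.integrable_comp hm hx2
      have hi1 : Integrable (fun ω => f (x (k + 1) ω)) μ := hf.integrable_comp hm hx2'
      have hiG : Integrable (fun ω => ‖gradient f (x k ω)‖ ^ 2) μ :=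
        (hf.memLp_gradient hβ hx2).integrable_norm_pow'
      have hiN : Integrable (fun ω => ‖N ω‖ ^ 2) μ := hN2.integrable_norm_pow'
      have hstep : ∀ ω, f (x (k + 1) ω) ≤ f (x k ω) - 1 / (2 * β) * ‖gradient f (x k ω)‖ ^ 2
          + 1 / (2 * β) * ‖N ω‖ ^ 2 := fun ω => by
        have := hf.sub_gradient_step_le hβ (x k ω) (N ω)
        rwa [hN, add_sub_cancel] at this
      have hs : Integrable (fun ω => f (x k ω) - 1 / (2 * β) * ‖gradient f (x k ω)‖ ^ 2) μ :=
        hi0.sub (hiG.const_mul _)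
      have h := integral_mono hi1 (hs.add (hiN.const_mul _)) hstep
      simp only [Pi.add_apply] at h
      rw [integral_add hs (hiN.const_mul _), integral_sub hi0 (hiG.const_mul _),
        integral_const_mul, integral_const_mul] at h
      have h' := mul_le_mul_of_nonneg_left h (by positivity : 0 ≤ 2 * β)
      have e : ∀ a b c : ℝ, 2 * β * (a - 1 / (2 * β) * b + 1 / (2 * β) * c)
          = 2 * β * a - b + c := fun a b c => by field_simp
      rw [e] at h'
      rw [Finset.sum_range_succ]
      have := ih (by omega)
      push_cast
      linarith
  refine (key K le_rfl).trans ?_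
  have hx2 := (sgdPoint_regular hξ hg hf hβ hB hJ w₁ (1 / β) (k := K) le_rfl).2
  -- The telescoped sum ends in the expected final value, which the lower bound on `f` controls.
  have : m ≤ ∫ ω, f (x K ω) ∂μ := by
    calc m = ∫ _, m ∂μ := by simp
      _ ≤ _ := integral_mono (integrable_const _) (hf.integrable_comp hm hx2) fun ω => hm _
  gcongr

/-- Mini-batch SGD with a uniformly drawn output. -/
theorem sgd_run_bound (hξ : IsIIDSample ξ P μ) (hg : IsUnbiasedOracle f g P σ)
    (hf : IsSmooth f β) (hβ : 0 < β) (hB : 0 < B) (hK : 0 < K) (hJ : IsBatching B K J) (w₁ : E)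
    {m : ℝ} (hm : ∀ x, m ≤ f x) {R : Ω → ℕ} (hR : IsUniformIndex R K μ)
    (hRξ : IndepFun R (fun ω t => ξ t ω) μ) {w : Ω → E}
    (hw : ∀ ω, w ω = (sgd w₁ (1 / β) (R ω)).output ((sgd w₁ (1 / β) (R ω)).run
      (fun j => batchMean B (fun t w => g w (ξ t ω)) (J j)) K)) :
    Integrable (fun ω => ‖gradient f (w ω)‖ ^ 2) μ ∧
      ∫ ω, ‖gradient f (w ω)‖ ^ 2 ∂μ ≤ 2 * β * (f w₁ - m) / K + σ ^ 2 / B := by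
  set x : ℕ → Ω → E := fun k ω => sgdPoint w₁ (1 / β)
    (fun j => batchMean B (fun t w => g w (ξ t ω)) (J j)) k with hx
  have hreg : ∀ k ∈ Finset.Icc 1 K, k - 1 ≤ K := fun k hk => by
    have := Finset.mem_Icc.1 hk; omega
  -- `R` is independent of the whole sample sequence, hence of each iterate.
  have hle : ∀ U, sampleSigma ξ U ≤ MeasurableSpace.comap (fun ω t => ξ t ω) inferInstance :=
    fun U => iSup₂_le fun t _ => by
      have h : Measurable[MeasurableSpace.comap (fun ω t => ξ t ω) MeasurableSpace.pi] (ξ t) :=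
        (measurable_pi_apply t).comp (comap_measurable fun ω t => ξ t ω)
      exact h.comap_le
  obtain ⟨h1, h2⟩ := hR.integral_eq hK (Y := fun k ω => ‖gradient f (x (k - 1) ω)‖ ^ 2)
    (fun k hk => (hf.memLp_gradient hβ
      (sgdPoint_regular hξ hg hf hβ hB hJ w₁ (1 / β) (hreg k hk)).2).integrable_norm_pow')
    (fun k hk => by
      rw [IndepFun_iff_Indep] at hRξ ⊢
      have hY : Measurable[sampleSigma ξ (usedRounds J (k - 1))]
          (fun ω => ‖gradient f (x (k - 1) ω)‖ ^ 2) :=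
        (hf.continuous_gradient.norm.pow 2).measurable.comp
          (sgdPoint_regular hξ hg hf hβ hB hJ w₁ (1 / β) (hreg k hk)).1
      exact indep_of_indep_of_le_right hRξ (hY.comap_le.trans (hle (usedRounds J (k - 1)))))
    (W := fun ω => ‖gradient f (w ω)‖ ^ 2) (fun ω hω => by
      simp only [hw ω, sgd_run]
      simp only [sgd, if_pos hω, hx])
  refine ⟨h1, ?_⟩
  rw [h2]
  have h3 := sum_integral_gradient_sq_le hξ hg hf hβ hB hJ w₁ hm
  have h4 : ∑ k ∈ Finset.Icc 1 K, ∫ ω, ‖gradient f (x (k - 1) ω)‖ ^ 2 ∂μ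
      = ∑ k ∈ Finset.range K, ∫ ω, ‖gradient f (x k ω)‖ ^ 2 ∂μ := by
    rw [Finset.range_eq_Ico, ← Finset.Ico_add_one_right_eq_Icc]
    exact (Finset.sum_Ico_add' (fun k => ∫ ω, ‖gradient f (x (k - 1) ω)‖ ^ 2 ∂μ) 0 K 1).symm
  rw [h4]
  calc _ ≤ 1 / (K : ℝ) * (2 * β * (f w₁ - m) + K * (σ ^ 2 / B)) := by gcongr
    _ = _ := by field_simp

lemma accSGD_run_regular (hξ : IsIIDSample ξ P μ) (hg : IsUnbiasedOracle f g P σ)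
    (hf : IsSmooth f β) (hβ : 0 < β) (hB : 0 < B) (hJ : IsBatching B K J) (w₁ : E) (γ : ℝ)
    {k : ℕ} (hk : k ≤ K) {s : Ω → AccState E} (hs : ∀ ω, s ω = (accSGD w₁ γ).run
      (fun j => batchMean B (fun t w => g w (ξ t ω)) (J j)) k) :
    (Measurable[sampleSigma ξ (usedRounds J k)] (fun ω => (s ω).center) ∧
      Measurable[sampleSigma ξ (usedRounds J k)] (fun ω => (s ω).agg)) ∧
    MemLp (fun ω => (s ω).center) 2 μ ∧ MemLp (fun ω => (s ω).agg) 2 μ := by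
  induction k generalizing s with
  | zero =>
    have hs' : s = fun _ => ⟨1, w₁, w₁⟩ := funext hs
    rw [hs']
    exact ⟨⟨measurable_const, measurable_const⟩, memLp_const _, memLp_const _⟩
  | succ k ih =>
    set s₀ : Ω → AccState E := fun ω => (accSGD w₁ γ).run
      (fun j => batchMean B (fun t w => g w (ξ t ω)) (J j)) k with hs₀
    obtain ⟨⟨hx, hy⟩, hx2, hy2⟩ := ih (s := s₀) (by omega) fun ω => rfl
    set a : ℝ := 2 / (((k + 1 : ℕ) : ℝ) + 1) with ha
    have hz : Measurable[sampleSigma ξ (usedRounds J k)]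
        (fun ω => (1 - a) • (s₀ ω).agg + a • (s₀ ω).center) :=
      (hy.const_smul (1 - a)).add (hx.const_smul a)
    have hz2 : MemLp (fun ω => (1 - a) • (s₀ ω).agg + a • (s₀ ω).center) 2 μ :=
      (hy2.const_smul (1 - a)).add (hx2.const_smul a)
    set z : Ω → E := fun ω => (1 - a) • (s₀ ω).agg + a • (s₀ ω).center with hzdef
    obtain ⟨hN, hN2, -, -⟩ := hξ.batchMean_error hg hf hB (hJ.card k (by omega))
      (hJ.disjoint_usedRounds k) hz
    have hmono := sampleSigma_mono ξ (Set.subset_union_left (s := usedRounds J k)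
      (t := (J k : Set ℕ)))
    have hG := hf.continuous_gradient.measurable.comp (hz.mono hmono le_rfl)
    have hc : ∀ ω, (s ω).center = (s₀ ω).center - (γ * ((k + 1 : ℕ) : ℝ)) •
        ((batchMean B (fun t w => g w (ξ t ω)) (J k) (z ω) - gradient f (z ω))
          + gradient f (z ω)) := fun ω => by
      rw [hs, sub_add_cancel]
      simp only [FirstOrderMethod.run]
      simp only [accSGD, hzdef, ha, ← accSGD_run_step w₁ γ
        (fun j => batchMean B (fun t w => g w (ξ t ω)) (J j)) k]
      rfl
    have ha' : ∀ ω, (s ω).agg = (1 - a) • (s₀ ω).agg + a • (s ω).center := fun ω => by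
      rw [hs]
      simp only [FirstOrderMethod.run]
      simp only [accSGD, ha, ← accSGD_run_step w₁ γ
        (fun j => batchMean B (fun t w => g w (ξ t ω)) (J j)) k]
      rfl
    have hcm : Measurable[sampleSigma ξ (usedRounds J k ∪ (J k : Set ℕ))]
        (fun ω => (s ω).center) := by
      simp only [hc]
      exact (hx.mono hmono le_rfl).sub ((hN.add hG).const_smul _)
    have hc2 : MemLp (fun ω => (s ω).center) 2 μ := by
      simp only [hc]
      exact hx2.sub ((hN2.add (hf.memLp_gradient hβ hz2)).const_smul _)
    rw [usedRounds_succ]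
    simp only [ha']
    exact ⟨⟨hcm, ((hy.mono hmono le_rfl).const_smul _).add (hcm.const_smul _)⟩, hc2,
      (hy2.const_smul _).add (hc2.const_smul _)⟩

/-- Mini-batch accelerated SGD with step sizes `k / (4 β)`. -/
theorem accSGD_run_bound (hξ : IsIIDSample ξ P μ) (hg : IsUnbiasedOracle f g P σ)
    (hf : IsSmooth f β) (hβ : 0 < β) (hc : ConvexOn ℝ Set.univ f) (hB : 0 < B)
    (hJ : IsBatching B K J) (w₁ : E) {ws : E} (hws : ∀ x, f ws ≤ f x) {w : Ω → E}
    (hw : ∀ ω, w ω = (accSGD w₁ (1 / (4 * β))).output ((accSGD w₁ (1 / (4 * β))).run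
      (fun j => batchMean B (fun t w => g w (ξ t ω)) (J j)) K)) :
    Integrable (fun ω => f (w ω) - f ws) μ ∧
      (K : ℝ) * (K + 1) / 2 * ∫ ω, (f (w ω) - f ws) ∂μ ≤ 2 * β * ‖w₁ - ws‖ ^ 2
        + K * (K + 1) * (2 * K + 1) / 6 * (σ ^ 2 / B / (4 * β)) := by
  set s : ℕ → Ω → AccState E := fun k ω => (accSGD w₁ (1 / (4 * β))).run
    (fun j => batchMean B (fun t w => g w (ξ t ω)) (J j)) k with hs
  have hreg := fun k (hk : k ≤ K) =>
    accSGD_run_regular hξ hg hf hβ hB hJ w₁ (1 / (4 * β)) hk (s := s k) fun ω => rfl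
  have hif : ∀ k ≤ K, Integrable (fun ω => f (s k ω).agg - f ws) μ := fun k hk =>
    (hf.integrable_comp hws (hreg k hk).2.2).sub (integrable_const _)
  have hid : ∀ k ≤ K, MemLp (fun ω => (s k ω).center - ws) 2 μ := fun k hk =>
    (hreg k hk).2.1.sub (memLp_const _)
  -- The expected potential of `acc_step` grows only by the noise terms `k² σ² / (4βB)`; summing the
  -- squares gives `k(k+1)(2k+1)/6`.
  have key : ∀ k ≤ K, (k : ℝ) * (k + 1) / 2 * ∫ ω, (f (s k ω).agg - f ws) ∂μ
      + 2 * β * ∫ ω, ‖(s k ω).center - ws‖ ^ 2 ∂μ ≤ 2 * β * ‖w₁ - ws‖ ^ 2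
        + k * (k + 1) * (2 * k + 1) / 6 * (σ ^ 2 / B / (4 * β)) := by
    intro k hk
    induction k with
    | zero => simp [hs, FirstOrderMethod.run, accSGD]
    | succ k ih =>
      obtain ⟨⟨hx, hy⟩, hx2, hy2⟩ := hreg k (by omega)
      set a : ℝ := 2 / (((k + 1 : ℕ) : ℝ) + 1) with ha
      set z : Ω → E := fun ω => (1 - a) • (s k ω).agg + a • (s k ω).center with hzdef
      have hz : Measurable[sampleSigma ξ (usedRounds J k)] z :=
        (hy.const_smul (1 - a)).add (hx.const_smul a)
      obtain ⟨-, hN2, hNv, hN0⟩ := hξ.batchMean_error hg hf hB (hJ.card k (by omega))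
        (hJ.disjoint_usedRounds k) hz
      set N : Ω → E := fun ω => batchMean B (fun t w => g w (ξ t ω)) (J k) (z ω)
        - gradient f (z ω) with hN
      have hcen : ∀ ω, (s (k + 1) ω).center = (s k ω).center
          - (1 / (4 * β) * ((k + 1 : ℕ) : ℝ)) • (gradient f (z ω) + N ω) := fun ω => by
        rw [hN, add_sub_cancel]
        simp only [hs, FirstOrderMethod.run]
        simp only [accSGD, hzdef, ha, ← accSGD_run_step w₁ (1 / (4 * β))
          (fun j => batchMean B (fun t w => g w (ξ t ω)) (J j)) k]
        rfl
      have hagg : ∀ ω, (s (k + 1) ω).agg = (1 - a) • (s k ω).agg + a • (s (k + 1) ω).center :=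
        fun ω => by
          simp only [hs, FirstOrderMethod.run]
          simp only [accSGD, ha, ← accSGD_run_step w₁ (1 / (4 * β))
            (fun j => batchMean B (fun t w => g w (ξ t ω)) (J j)) k]
      have hstep := fun ω => acc_step hf hβ hc ws (s k ω).center (s k ω).agg (N ω)
        (k := ((k + 1 : ℕ) : ℝ)) (by simp) (z := z ω) rfl (hcen ω) (hagg ω)
      set κ : ℝ := ((k + 1 : ℕ) : ℝ) with hκ
      have hi1 := (hif (k + 1) hk).const_mul (κ * (κ + 1) / 2)
      have hi2 := (hid (k + 1) hk).integrable_norm_pow'.const_mul (2 * β)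
      have hi3 := (hif k (by omega)).const_mul ((κ - 1) * κ / 2)
      have hi4 := (hid k (by omega)).integrable_norm_pow'.const_mul (2 * β)
      have hi5 := (integrable_inner_of_memLp (hid k (by omega)) hN2).const_mul κ
      have hi6 := hN2.integrable_norm_pow'.const_mul (κ ^ 2 / (4 * β))
      have h := integral_mono (hi1.add hi2) (((hi3.add hi4).sub hi5).add hi6) hstep
      rw [integral_add' hi1 hi2, integral_add' ((hi3.add hi4).sub hi5) hi6,
        integral_sub' (hi3.add hi4) hi5, integral_add' hi3 hi4] at h
      simp only [integral_const_mul] at h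
      -- Unbiasedness kills the cross term: the center depends on earlier batches only.
      rw [hN0 (fun ω => (s k ω).center - ws) (hx.sub measurable_const) (hid k (by omega))] at h
      have h6 := mul_le_mul_of_nonneg_left hNv (by positivity : 0 ≤ κ ^ 2 / (4 * β))
      have hih := ih (by omega)
      have e1 : (κ - 1) * κ / 2 = (k : ℝ) * (k + 1) / 2 := by
        rw [hκ]; push_cast; ring
      have e2 : κ ^ 2 / (4 * β) * (σ ^ 2 / B) = κ ^ 2 * (σ ^ 2 / B / (4 * β)) := by
        field_simp
      have e3 : κ * (κ + 1) * (2 * κ + 1) / 6 * (σ ^ 2 / B / (4 * β))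
          = (k : ℝ) * (k + 1) * (2 * k + 1) / 6 * (σ ^ 2 / B / (4 * β))
            + κ ^ 2 * (σ ^ 2 / B / (4 * β)) := by
        rw [hκ]; push_cast; ring
      rw [e1] at h
      rw [e2] at h6
      rw [e3]
      linarith
  have hw' : ∀ ω, w ω = (s K ω).agg := hw
  simp only [hw']
  refine ⟨hif K le_rfl, le_trans ?_ (key K le_rfl)⟩
  have : 0 ≤ 2 * β * ∫ ω, ‖(s K ω).center - ws‖ ^ 2 ∂μ :=
    mul_nonneg (by positivity) (integral_nonneg fun ω => by positivity)
  linarith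

end Runs
/-! ### Epoch lengths, batch sizes, and the number of completed epochs -/

section Rates

lemma epochLength_pos (i : ℕ) : 0 < epochLength i := by simp [epochLength]

lemma epochLength_succ (j : ℕ) : (epochLength (j + 1) : ℝ) = 2 ^ j := by simp [epochLength]

lemma two_mul_epochLength {e : ℕ} (he : e ≠ 0) : 2 * (epochLength e : ℝ) = 2 ^ e := by
  obtain ⟨j, rfl⟩ := Nat.exists_eq_succ_of_ne_zero he
  rw [Nat.succ_eq_add_one, epochLength_succ]
  ring

lemma max_one_ceil_le {x : ℝ} (hx : 0 ≤ x) : ((max 1 ⌈x⌉₊ : ℕ) : ℝ) ≤ 1 + x := by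
  rw [Nat.cast_max, max_le_iff]
  have := Nat.ceil_lt_add_one hx
  constructor
  · simpa using hx
  · linarith

lemma le_max_one_ceil (x : ℝ) : x ≤ ((max 1 ⌈x⌉₊ : ℕ) : ℝ) :=
  (Nat.le_ceil x).trans (Nat.cast_le.2 (le_max_right _ _))

/-- Delays are integers, so the real threshold may be rounded down to fit the counting bound. -/
lemma IsDelayQuantile.mul_le_card {d : ℕ → ℕ} {T : ℕ} {q τ : ℝ} (hT : 0 < T)
    (h : IsDelayQuantile d T q τ) :
    q * T ≤ (((Finset.Icc 1 T).filter fun r => d r ≤ ⌊τ⌋₊).card : ℝ) := by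
  have h1 := h.le_prob
  rw [le_div_iff₀ (by positivity)] at h1
  simpa only [Nat.le_floor_iff h.nonneg] using h1

/-- If `e` epochs fit, the rounds with delay at most `τ` are covered by `e + 1` epochs. -/
lemma IsDelayQuantile.mul_le_sum {d : ℕ → ℕ} {T : ℕ} {q τ : ℝ} (hT : 0 < T)
    (h : IsDelayQuantile d T q τ) {B : ℕ → ℕ} {e : ℕ}
    (hcard : ∀ θ : ℕ, ((Finset.Icc 1 T).filter fun r => d r ≤ θ).card ≤
        ∑ j ∈ Finset.range (e + 1), epochLength (j + 1) * (B (j + 1) + θ))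
    {b : ℕ → ℝ} (hB : ∀ j, (B (j + 1) : ℝ) ≤ 1 + b j) :
    q * T ≤ ∑ j ∈ Finset.range (e + 1), (2 : ℝ) ^ j * (1 + τ + b j) := by
  refine (h.mul_le_card hT).trans ((Nat.cast_le.2 (hcard _)).trans ?_)
  push_cast
  refine Finset.sum_le_sum fun j _ => ?_
  rw [epochLength_succ]
  have := hB j
  have := Nat.floor_le h.nonneg
  refine mul_le_mul_of_nonneg_left ?_ (by positivity)
  linarith

lemma sum_two_pow_mul_le {a c : ℝ} (ha : 0 ≤ a) (hc : 0 ≤ c) (e : ℕ) :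
    ∑ j ∈ Finset.range (e + 1), (2 : ℝ) ^ j * (a + c * 2 ^ j) ≤
      2 * 2 ^ e * a + 4 / 3 * c * (2 ^ e) ^ 2 := by
  induction e with
  | zero => simp; linarith
  | succ e ih =>
    rw [Finset.sum_range_succ, pow_succ]
    nlinarith

lemma sum_two_pow_mul_le' {a c : ℝ} (ha : 0 ≤ a) (hc : 0 ≤ c) (e : ℕ) :
    ∑ j ∈ Finset.range (e + 1), (2 : ℝ) ^ j * (a + c * (2 ^ j) ^ 3) ≤
      2 * 2 ^ e * a + 16 / 15 * c * (2 ^ e) ^ 4 := by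
  induction e with
  | zero => simp; linarith
  | succ e ih =>
    rw [Finset.sum_range_succ, pow_succ]
    nlinarith

/-- Here `M = 2 ^ e` and `Q = qT`. In the dimensionless `u` and `v` the count reads `1 ≤ 2u +
(2/3)v²`, and the target follows from `1 ≤ 3u + 3v`: either `v ≥ 1/3`, or the quadratic term is so
small that `u ≥ 1/3`. -/
lemma sgd_rate {β F σ τ Q M : ℝ} (hβ : 0 < β) (hF : 0 < F) (hσ : 0 ≤ σ) (hτ : 0 ≤ τ) (hQ : 0 < Q)
    (hM : 0 < M) (h : Q ≤ 2 * M * (1 + τ) + 4 / 3 * (σ ^ 2 / (2 * β * F)) * M ^ 2) :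
    8 * β * F / M ≤ 24 * (1 + 2 * τ) * β * F / Q + 24 * σ * √(β * F) / √Q := by
  set r := √(β * F) with hr
  set s := √Q with hs
  have hr0 : 0 < r := Real.sqrt_pos.2 (by positivity)
  have hs0 : 0 < s := Real.sqrt_pos.2 hQ
  have hr2 : β * F = r ^ 2 := (Real.sq_sqrt (by positivity)).symm
  have hs2 : Q = s ^ 2 := (Real.sq_sqrt hQ.le).symm
  set u := M * (1 + τ) / s ^ 2 with hu
  set v := M * σ / (r * s) with hv
  have hu0 : 0 ≤ u := by positivity
  have hv0 : 0 ≤ v := by positivity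
  have h1 : 1 ≤ 2 * u + 2 / 3 * v ^ 2 := by
    have : s ^ 2 * 1 ≤ s ^ 2 * (2 * u + 2 / 3 * v ^ 2) := by
      rw [mul_one, ← hs2]
      refine h.trans (le_of_eq ?_)
      rw [mul_assoc 2 β F, hr2, hs2, hu, hv]
      field_simp
      ring
    exact le_of_mul_le_mul_left this (by positivity)
  have h2 : 1 ≤ 3 * u + 3 * v := by
    by_cases hv1 : 1 / 3 ≤ v
    · linarith
    · nlinarith
  have e1 : 24 * (1 + τ) * (β * F) / Q + 24 * σ * r / s = 8 * (β * F) / M * (3 * u + 3 * v) := by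
    rw [hr2, hs2, hu, hv]
    field_simp
    ring
  have h3 : 8 * (β * F) / M * 1 ≤ 8 * (β * F) / M * (3 * u + 3 * v) := by gcongr
  have h4 : 24 * (1 + τ) * (β * F) / Q ≤ 24 * (1 + 2 * τ) * (β * F) / Q := by
    gcongr
    linarith
  rw [mul_assoc 8, mul_assoc _ β F]
  linarith

lemma acc_rate {β D σ τ Q M : ℝ} (hβ : 0 < β) (hD : 0 < D) (hσ : 0 ≤ σ) (hτ : 0 ≤ τ) (hQ : 0 < Q)
    (hM : 0 < M) (h : Q ≤ 2 * M * (1 + τ)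
      + 16 / 15 * (4 * (σ ^ 2 / (12 * β ^ 2 * D ^ 2))) * M ^ 4) :
    24 * β * D ^ 2 / M ^ 2 ≤ 192 * (1 + 2 * τ) ^ 2 * β * D ^ 2 / Q ^ 2 + 48 * σ * D / √Q := by
  set s := √Q with hs
  have hs0 : 0 < s := Real.sqrt_pos.2 hQ
  have hs2 : Q = s ^ 2 := (Real.sq_sqrt hQ.le).symm
  set u := M * (1 + τ) / s ^ 2 with hu
  set v := M ^ 2 * σ / (β * D * s) with hv
  have hu0 : 0 ≤ u := by positivity
  have hv0 : 0 ≤ v := by positivity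
  have h1 : 1 ≤ 2 * u + 16 / 45 * v ^ 2 := by
    have : s ^ 2 * 1 ≤ s ^ 2 * (2 * u + 16 / 45 * v ^ 2) := by
      rw [mul_one, ← hs2]
      refine h.trans (le_of_eq ?_)
      rw [hs2, hu, hv]
      field_simp
      ring
    exact le_of_mul_le_mul_left this (by positivity)
  -- Either `v ≥ 1/2`, or the count forces `u ≥ 2/5`, and then `8u² > 1`.
  have h2 : 1 ≤ 8 * u ^ 2 + 2 * v := by
    by_cases hv1 : 1 / 2 ≤ v
    · nlinarith
    · have hu1 : 2 / 5 ≤ u := by nlinarith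
      nlinarith
  have e1 : 192 * (1 + τ) ^ 2 * β * D ^ 2 / Q ^ 2 + 48 * σ * D / s
      = 24 * β * D ^ 2 / M ^ 2 * (8 * u ^ 2 + 2 * v) := by
    rw [hs2, hu, hv]
    field_simp
    ring
  have h3 : 24 * β * D ^ 2 / M ^ 2 * 1 ≤ 24 * β * D ^ 2 / M ^ 2 * (8 * u ^ 2 + 2 * v) := by gcongr
  have h4 : 192 * (1 + τ) ^ 2 * β * D ^ 2 / Q ^ 2 ≤ 192 * (1 + 2 * τ) ^ 2 * β * D ^ 2 / Q ^ 2 := by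
    gcongr
    linarith
  linarith

end Rates

/-! ### Error bounds for the two sweeps. -/

section Sweeps

variable {E : Type*} [NormedAddCommGroup E] [InnerProductSpace ℝ E] [CompleteSpace E]
  [MeasurableSpace E] [BorelSpace E] [SecondCountableTopology E]
  {Ω Z : Type*} [MeasurableSpace Ω] [MeasurableSpace Z] {μ : Measure Ω} [IsProbabilityMeasure μ]
  {P : Measure Z} {f : E → ℝ} {β σ : ℝ} {g : E → Z → E} {ξ : ℕ → Ω → Z}

theorem sgd_sweep_bound (hξ : IsIIDSample ξ P μ) (hg : IsUnbiasedOracle f g P σ)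
    (hf : IsSmooth f β) (hβ : 0 < β) (hσ : 0 ≤ σ) {T : ℕ} (hT : 0 < T) (d : ℕ → ℕ) (w₁ : E)
    {m F : ℝ} (hm : ∀ x, m ≤ f x) (hF : f w₁ - m ≤ F) (hF0 : 0 < F) {R : ℕ → Ω → ℕ}
    (hR : ∀ i, 1 ≤ i → IsUniformIndex (R i) (epochLength i) μ)
    (hRξ : ∀ i, 1 ≤ i → IndepFun (R i) (fun ω t => ξ t ω) μ) {w : Ω → E}
    (hw : ∀ ω, w ω = sweepOutput (fun i => sgd w₁ (1 / β) (R i ω)) epochLength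
      (batchSGD σ β F) d (fun t w => g w (ξ t ω)) w₁ T) :
    Integrable (fun ω => ‖gradient f (w ω)‖ ^ 2) μ ∧
      ∀ q τ : ℝ, 0 < q → IsDelayQuantile d T q τ → ∫ ω, ‖gradient f (w ω)‖ ^ 2 ∂μ ≤
        24 * (1 + 2 * τ) * β * F / (q * T) + 24 * σ * √(β * F) / √(q * T) := by
  have hB : ∀ i, 0 < batchSGD σ β F i := fun i => lt_max_of_lt_left zero_lt_one
  obtain ⟨e, J, hJ, hcard, hout⟩ := exists_sweepOutput_eq (S := SGDState E) (E := E)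
    epochLength (batchSGD σ β F) d epochLength_pos hB T
  have hmain : Integrable (fun ω => ‖gradient f (w ω)‖ ^ 2) μ ∧
      ∫ ω, ‖gradient f (w ω)‖ ^ 2 ∂μ ≤ 8 * β * F / 2 ^ e := by
    by_cases he : e = 0
    · have hw' : ∀ ω, w ω = w₁ := fun ω => by rw [hw, hout, if_pos he]
      simp only [hw', integral_const, probReal_univ, one_smul, he, pow_zero, div_one]
      refine ⟨integrable_const _, (hf.norm_gradient_sq_le hβ hm w₁).trans ?_⟩
      nlinarith
    · have hw' : ∀ ω, w ω = (sgd w₁ (1 / β) (R e ω)).output ((sgd w₁ (1 / β) (R e ω)).run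
          (fun j => batchMean (batchSGD σ β F e) (fun t w => g w (ξ t ω)) (J j))
          (epochLength e)) := fun ω => by rw [hw, hout, if_neg he]
      have h1e := Nat.one_le_iff_ne_zero.2 he
      obtain ⟨h1, h2⟩ := sgd_run_bound hξ hg hf hβ (hB e) (epochLength_pos e) (hJ he) w₁ hm
        (hR e h1e) (hRξ e h1e) hw'
      refine ⟨h1, h2.trans ?_⟩
      have hK := epochLength_pos e
      have hB' : (0 : ℝ) < batchSGD σ β F e := Nat.cast_pos.2 (hB e)
      have hle : σ ^ 2 * (epochLength e : ℝ) / (2 * β * F) ≤ batchSGD σ β F e :=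
        le_max_one_ceil _
      -- The batch size is tuned so that the noise does not exceed the optimization term.
      have h3 : σ ^ 2 / batchSGD σ β F e ≤ 2 * β * F / epochLength e := by
        rw [div_le_div_iff₀ hB' (by positivity)]
        rwa [div_le_iff₀' (by positivity)] at hle
      have h4 : 2 * β * (f w₁ - m) / epochLength e ≤ 2 * β * F / epochLength e := by gcongr
      rw [← two_mul_epochLength he]
      have e5 : 8 * β * F / (2 * (epochLength e : ℝ))
          = 2 * β * F / epochLength e + 2 * β * F / epochLength e := by field_simp; ring
      rw [e5]
      exact add_le_add h4 h3
  refine ⟨hmain.1, fun q τ hq hτ => hmain.2.trans ?_⟩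
  have h1 := hτ.mul_le_sum hT hcard (b := fun j => σ ^ 2 / (2 * β * F) * 2 ^ j) fun j => by
    refine (max_one_ceil_le (by positivity)).trans (le_of_eq ?_)
    rw [epochLength_succ]
    ring
  have hτ0 := hτ.nonneg
  exact sgd_rate hβ hF0 hσ hτ0 (by positivity) (by positivity)
    (h1.trans (sum_two_pow_mul_le (by positivity) (by positivity) e))

theorem accSGD_sweep_bound (hξ : IsIIDSample ξ P μ) (hg : IsUnbiasedOracle f g P σ)
    (hf : IsSmooth f β) (hβ : 0 < β) (hσ : 0 ≤ σ) {T : ℕ} (hT : 0 < T) (d : ℕ → ℕ) (w₁ : E)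
    (hc : ConvexOn ℝ Set.univ f) {ws : E} {D : ℝ} (hws : ∀ x, f ws ≤ f x) (hD : ‖w₁ - ws‖ ≤ D)
    (hD0 : 0 < D) {w : Ω → E}
    (hw : ∀ ω, w ω = sweepOutput (fun _ => accSGD w₁ (1 / (4 * β))) epochLength
      (batchAcc σ β D) d (fun t w => g w (ξ t ω)) w₁ T) :
    Integrable (fun ω => f (w ω) - f ws) μ ∧
      ∀ q τ : ℝ, 0 < q → IsDelayQuantile d T q τ → ∫ ω, (f (w ω) - f ws) ∂μ ≤
        192 * (1 + 2 * τ) ^ 2 * β * D ^ 2 / (q ^ 2 * (T : ℝ) ^ 2)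
          + 48 * σ * D / √(q * T) := by
  have hB : ∀ i, 0 < batchAcc σ β D i := fun i => lt_max_of_lt_left zero_lt_one
  obtain ⟨e, J, hJ, hcard, hout⟩ := exists_sweepOutput_eq (S := AccState E) (E := E)
    epochLength (batchAcc σ β D) d epochLength_pos hB T
  have hmain : Integrable (fun ω => f (w ω) - f ws) μ ∧
      ∫ ω, (f (w ω) - f ws) ∂μ ≤ 24 * β * D ^ 2 / (2 ^ e) ^ 2 := by
    have hD2 : ‖w₁ - ws‖ ^ 2 ≤ D ^ 2 := by gcongr
    by_cases he : e = 0
    · have hw' : ∀ ω, w ω = w₁ := fun ω => by rw [hw, hout, if_pos he]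
      simp only [hw', integral_const, probReal_univ, one_smul, he, pow_zero, one_pow, div_one]
      refine ⟨integrable_const _, (hf.sub_min_le hβ hws w₁).trans ?_⟩
      have : β / 2 * ‖w₁ - ws‖ ^ 2 ≤ β / 2 * D ^ 2 := by gcongr
      have : 0 ≤ β * D ^ 2 := by positivity
      linarith
    · have hw' : ∀ ω, w ω = (accSGD w₁ (1 / (4 * β))).output ((accSGD w₁ (1 / (4 * β))).run
          (fun j => batchMean (batchAcc σ β D e) (fun t w => g w (ξ t ω)) (J j))
          (epochLength e)) := fun ω => by rw [hw, hout, if_neg he]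
      obtain ⟨h1, h2⟩ := accSGD_run_bound hξ hg hf hβ hc (hB e) (hJ he) w₁ hws hw'
      refine ⟨h1, ?_⟩
      rw [← two_mul_epochLength he]
      set I := ∫ ω, (f (w ω) - f ws) ∂μ
      have hB' : (0 : ℝ) < batchAcc σ β D e := Nat.cast_pos.2 (hB e)
      have hle : σ ^ 2 * (epochLength e : ℝ) * ((epochLength e : ℝ) + 1) ^ 2
          / (12 * β ^ 2 * D ^ 2) ≤ batchAcc σ β D e := le_max_one_ceil _
      have hK : (0 : ℝ) < epochLength e := Nat.cast_pos.2 (epochLength_pos e)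
      set K : ℝ := (epochLength e : ℝ)
      set b : ℝ := (batchAcc σ β D e : ℝ)
      have hI : 0 ≤ I := integral_nonneg fun ω => sub_nonneg.2 (hws _)
      have h3 : σ ^ 2 / b / (4 * β) ≤ 3 * β * D ^ 2 / (K * (K + 1) ^ 2) := by
        rw [div_div, div_le_div_iff₀ (by positivity) (by positivity)]
        rw [div_le_iff₀' (by positivity)] at hle
        linarith
      -- The noise adds at most `βD²` to the initial `2βD²`, so `K(K+1)/2 * I ≤ 3βD²`. Dropping a
      -- `K` gives `6βD² / K²`, that is `24βD² / (2K)²`.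
      have h4 : K * (K + 1) * (2 * K + 1) / 6 * (σ ^ 2 / b / (4 * β)) ≤ β * D ^ 2 := by
        calc _ ≤ K * (K + 1) * (2 * K + 1) / 6 * (3 * β * D ^ 2 / (K * (K + 1) ^ 2)) := by gcongr
          _ = (2 * K + 1) / (2 * (K + 1)) * (β * D ^ 2) := by field_simp; ring
          _ ≤ 1 * (β * D ^ 2) := by
            gcongr
            rw [div_le_one (by positivity)]
            linarith
          _ = _ := one_mul _
      have h5 : 2 * β * ‖w₁ - ws‖ ^ 2 ≤ 2 * β * D ^ 2 := by gcongr
      rw [le_div_iff₀ (by positivity)]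
      have h6 : 0 ≤ K * I := by positivity
      nlinarith
  refine ⟨hmain.1, fun q τ hq hτ => hmain.2.trans ?_⟩
  have h1 := hτ.mul_le_sum hT hcard
    (b := fun j => 4 * (σ ^ 2 / (12 * β ^ 2 * D ^ 2)) * (2 ^ j) ^ 3) fun j => by
    refine (max_one_ceil_le (by positivity)).trans ?_
    rw [epochLength_succ]
    have h2 : (1 : ℝ) ≤ 2 ^ j := one_le_pow₀ (by norm_num)
    -- This makes the batch bound a pure cube of the epoch length, at the cost of the factor `4`
    -- seen in `acc_rate`.
    have h3 : ((2 : ℝ) ^ j + 1) ^ 2 ≤ (2 * 2 ^ j) ^ 2 := by gcongr; linarith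
    have h4 : σ ^ 2 * 2 ^ j * ((2 : ℝ) ^ j + 1) ^ 2 / (12 * β ^ 2 * D ^ 2)
        ≤ σ ^ 2 * 2 ^ j * (2 * 2 ^ j) ^ 2 / (12 * β ^ 2 * D ^ 2) := by gcongr
    have h5 : σ ^ 2 * 2 ^ j * (2 * (2 : ℝ) ^ j) ^ 2 / (12 * β ^ 2 * D ^ 2)
        = 4 * (σ ^ 2 / (12 * β ^ 2 * D ^ 2)) * (2 ^ j) ^ 3 := by ring
    linarith
  have hτ0 := hτ.nonneg
  rw [← mul_pow]
  exact acc_rate hβ hD0 hσ hτ0 (by positivity) (by positivity)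
    (h1.trans (sum_two_pow_mul_le' (by positivity) (by positivity) e))

end Sweeps

end AsyncMiniBatch

theorem theorem3 {n : ℕ} {Ω Z : Type*} [MeasurableSpace Ω] [MeasurableSpace Z]
    (μ : Measure Ω) [IsProbabilityMeasure μ] (P : Measure Z)
    (f : EuclideanSpace ℝ (Fin n) → ℝ) (β σ : ℝ) (hβ : 0 < β) (hσ : 0 ≤ σ)
    (hf : IsSmooth f β)
    (g : EuclideanSpace ℝ (Fin n) → Z → EuclideanSpace ℝ (Fin n))
    (hg : IsUnbiasedOracle f g P σ)
    (ξ : ℕ → Ω → Z) (hξ : IsIIDSample ξ P μ)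
    (T : ℕ) (hT : 0 < T) (d : ℕ → ℕ) (hd : ∀ t ∈ Finset.Icc 1 T, d t < t)
    (τ : ℝ → ℝ) (hτ : ∀ q ∈ Set.Ioc (0 : ℝ) 1, IsDelayQuantile d T q (τ q))
    (w₁ : EuclideanSpace ℝ (Fin n)) :
    -- Smooth, possibly non-convex objective, with SGD.
    (∀ (fstar F : ℝ), (∀ x, fstar ≤ f x) → f w₁ - fstar ≤ F → 0 < F →
      ∀ (R : ℕ → Ω → ℕ), (∀ i, 1 ≤ i → IsUniformIndex (R i) (epochLength i) μ) →
      (∀ i, 1 ≤ i → IndepFun (R i) (fun ω t => ξ t ω) μ) →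
      ∀ (wHat : Ω → EuclideanSpace ℝ (Fin n)),
      (∀ ω, wHat ω = sweepOutput (fun i => sgd w₁ (1 / β) (R i ω)) epochLength
        (batchSGD σ β F) d (fun t w => g w (ξ t ω)) w₁ T) →
      Integrable (fun ω => ‖gradient f (wHat ω)‖ ^ 2) μ ∧
      ∫ ω, ‖gradient f (wHat ω)‖ ^ 2 ∂μ ≤
        ⨅ q : Set.Ioc (0 : ℝ) 1,
          (24 * (1 + 2 * τ q) * β * F / ((q : ℝ) * T)
            + 24 * σ * √(β * F) / √((q : ℝ) * T))) ∧
    -- Smooth convex objective, with accelerated SGD.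
    (∀ (wstar : EuclideanSpace ℝ (Fin n)) (D : ℝ), ConvexOn ℝ Set.univ f →
      (∀ x, f wstar ≤ f x) → ‖w₁ - wstar‖ ≤ D → 0 < D →
      ∀ (wHat : Ω → EuclideanSpace ℝ (Fin n)),
      (∀ ω, wHat ω = sweepOutput (fun _ => accSGD w₁ (1 / (4 * β))) epochLength
        (batchAcc σ β D) d (fun t w => g w (ξ t ω)) w₁ T) →
      Integrable (fun ω => f (wHat ω) - f wstar) μ ∧
      ∫ ω, (f (wHat ω) - f wstar) ∂μ ≤
        ⨅ q : Set.Ioc (0 : ℝ) 1,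
          (192 * (1 + 2 * τ q) ^ 2 * β * D ^ 2 / ((q : ℝ) ^ 2 * (T : ℝ) ^ 2)
            + 48 * σ * D / √((q : ℝ) * T))) := by
  have : Nonempty (Set.Ioc (0 : ℝ) 1) := ⟨⟨1, by norm_num⟩⟩
  constructor
  · intro fstar F hm hF hF0 R hR hRξ wHat hw
    obtain ⟨h1, h2⟩ := sgd_sweep_bound hξ hg hf hβ hσ hT d w₁ hm hF hF0 hR hRξ hw
    exact ⟨h1, le_ciInf fun q => h2 q (τ q) q.2.1 (hτ q q.2)⟩
  · intro wstar D hc hws hD hD0 wHat hw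
    obtain ⟨h1, h2⟩ := accSGD_sweep_bound hξ hg hf hβ hσ hT d w₁ hc hws hD hD0 hw
    exact ⟨h1, le_ciInf fun q => h2 q (τ q) q.2.1 (hτ q q.2)⟩
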